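/- Let $d,N\ge 1$ be integers and $s\in(0,\infty)$. Put $D=\{1,\dots,N\}^d\subset\mathbb Z^d$, let $\partial D$ be the set of points of $\mathbb Z^d\setminus D$ at Euclidean distance $1$ from some point of $D$, put $\overline D=D\cup\partial D$ and $\Omega=[0,\infty)^{D}$, and extend $\phi\in\Omega$ to $\overline D$ by $\phi_x=0$ for $x\in\partial D$. For $V:\mathbb R\to\mathbb R$ let $$H(\phi)=\tfrac12\sum_{x,y\in\overline D,\ |x-y|=1}V(\phi_x-\phi_y),\qquad d\mu(\phi)=\frac1Z\,e^{-H(\phi)}\prod_{x\in D}\bigl(s\,d\delta_0(\phi_x)+d\phi_x\bigr),\quad \phi\in\Omega,$$ where $d\phi_x$ is Lebesgue measure on $[0,\infty)$ and $Z$ is the normalizing constant. Assume that $V$ is continuously differentiable, bounded below and symmetric ($V(-r)=V(r)$), that $\int_{\mathbb R}e^{-V(r)}\,dr<\infty$, and that for every $x\in D$ the function $\phi\mapsto\sum_{y\in\overline D,\,|x-y|=1}V'(\phi_x-\phi_y)$ belongs to $L^2(\Omega;\mu)$. For $B\subset D$ let $\mu_B$ be the restriction of $\mu$ to $\{\phi\in\Omega:\phi_x>0\Leftrightarrow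 x\in B\}$. Let $C_c^2(\Omega)$ be the space of continuous functions $F:\Omega\to\mathbb R$ with compact support that are twice continuously differentiable on $(0,\infty)^D$ and whose partial derivatives of order at most $2$ extend continuously to $\Omega$; $\partial_xF$ denotes the continuous extension to $\Omega$ of the partial derivative in the variable $\phi_x$. Then $\mu$ is a probability measure, and $$\mathcal E(F,G)=\sum_{\varnothing\ne B\subset D}\ \sum_{x\in B}\int\partial_xF\,\partial_xG\,d\mu_B,\qquad F,G\in C_c^2(\Omega),$$ is a well-defined, densely defined, symmetric bilinear form on $L^2(\Omega;\mu)$ which is positive ($\mathcal E(F,F)\ge0$) and closable. Its closure is a conservative, strongly local, regular, symmetric Dirichlet form on $L^2(\Omega;\mu)$. Here a symmetric Dirichlet form is a densely defined, symmetric, positive, closed form on which the unit contraction $u\mapsto(u\vee0)\wedge1$ operates. Regular means that $\mu$ has full support and that $D(\mathcal E)\cap C_c(\Omega)$ is dense in $D(\mathcal E)$ for the norm of $\mathcal E_1=\mathcal E+(\cdot,\cdot)_{L^2}$ and uniformly dense in $C_c(\Omega)$. Strongly local means that $\mathcal E(u,v)=0$ if $u,v\in D(\mathcal E)$ have compact supports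 and $v$ is constant on a neighbourhood of the support of $u$. Conservative means that $1\in D(\mathcal E)$, $\mathcal E(1,1)=0$, and the associated $L^2$-semigroup satisfies $T_t1=1$ for all $t\ge0$. -/

import Mathlib

open MeasureTheory Filter Topology Set
open scoped NNReal ENNReal CompactlySupported

noncomputable section

namespace Wetting

/-! ### Symmetric forms and Dirichlet forms on `L²(X; μ)` -/

/-- A bilinear form on `L²(X; μ)` defined on a linear subspace. -/
structure L2Form {X : Type*} [MeasurableSpace X] (μ : Measure X) where
  domain : Submodule ℝ (Lp ℝ 2 μ)
  form : LinearMap.BilinForm ℝ domain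

namespace L2Form

section Basic

variable {X : Type*} [MeasurableSpace X] {μ : Measure X} (𝓔 : L2Form μ)

/-- The quadratic form `𝓔₁(u, u) = 𝓔(u, u) + ‖u‖²`. -/
def energyOne (u : 𝓔.domain) : ℝ := 𝓔.form u u + ‖(u : Lp ℝ 2 μ)‖ ^ 2

def IsDenselyDefined : Prop := Dense (𝓔.domain : Set (Lp ℝ 2 μ))

def IsSymm : Prop := ∀ u v : 𝓔.domain, 𝓔.form u v = 𝓔.form v u

/-- Positivity, `𝓔(u, u) ≥ 0`. -/
def IsPositive : Prop := ∀ u : 𝓔.domain, 0 ≤ 𝓔.form u u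

/-- `(u k)` is a Cauchy sequence with respect to `𝓔`. -/
def IsCauchy (u : ℕ → 𝓔.domain) : Prop :=
  Tendsto (fun p : ℕ × ℕ => 𝓔.form (u p.1 - u p.2) (u p.1 - u p.2)) atTop (𝓝 0)

/-- Closability on `L²(X; μ)`. -/
def IsClosable : Prop :=
  ∀ u : ℕ → 𝓔.domain, 𝓔.IsCauchy u →
    Tendsto (fun k => (u k : Lp ℝ 2 μ)) atTop (𝓝 0) →
    Tendsto (fun k => 𝓔.form (u k) (u k)) atTop (𝓝 0)

/-- Closedness: the domain is complete with respect to `𝓔₁`. -/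
def IsClosedForm : Prop :=
  ∀ u : ℕ → 𝓔.domain,
    Tendsto (fun p : ℕ × ℕ => 𝓔.energyOne (u p.1 - u p.2)) atTop (𝓝 0) →
    ∃ v : 𝓔.domain, Tendsto (fun k => 𝓔.energyOne (u k - v)) atTop (𝓝 0)

/-- `𝓕` is the closure of `𝓔`: a closed extension in whose domain the domain of `𝓔` is
`𝓕₁`-dense. -/
structure IsClosureOf (𝓕 𝓔 : L2Form μ) : Prop where
  le : 𝓔.domain ≤ 𝓕.domain
  form_eq : ∀ u v : 𝓔.domain,
    𝓕.form (Submodule.inclusion le u) (Submodule.inclusion le v) = 𝓔.form u v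
  closed : 𝓕.IsClosedForm
  dense : ∀ u : 𝓕.domain, ∃ w : ℕ → 𝓔.domain,
    Tendsto (fun k => 𝓕.energyOne (u - Submodule.inclusion le (w k))) atTop (𝓝 0)

/-- The Markov property: the unit contraction operates on the form. -/
def IsMarkovian : Prop :=
  ∀ (u : 𝓔.domain) (v : Lp ℝ 2 μ),
    (∀ᵐ x ∂μ, v x = min (max ((u : Lp ℝ 2 μ) x) 0) 1) →
    ∃ hv : v ∈ 𝓔.domain, 𝓔.form ⟨v, hv⟩ ⟨v, hv⟩ ≤ 𝓔.form u u

/-- Symmetric Dirichlet forms on `L²(X; μ)`. -/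
structure IsSymmDirichletForm : Prop where
  denselyDefined : 𝓔.IsDenselyDefined
  symm : 𝓔.IsSymm
  positive : 𝓔.IsPositive
  closed : 𝓔.IsClosedForm
  markovian : 𝓔.IsMarkovian

/-- A strongly continuous contraction semigroup of symmetric operators `T t`, `t ≥ 0`. -/
structure IsSymmSemigroup (T : ℝ → (Lp ℝ 2 μ →L[ℝ] Lp ℝ 2 μ)) : Prop where
  zero : ∀ f, T 0 f = f
  add : ∀ s t, 0 ≤ s → 0 ≤ t → ∀ f, T (s + t) f = T s (T t f)
  contraction : ∀ t, 0 ≤ t → ∀ f, ‖T t f‖ ≤ ‖f‖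
  symm : ∀ t, 0 ≤ t → ∀ f g, inner ℝ (T t f) g = inner ℝ f (T t g)
  continuous : ∀ f, Tendsto (fun t => T t f) (𝓝[>] 0) (𝓝 f)

/-- `T` is the `L²`-semigroup of `𝓔`: with the approximating forms
`𝓔⁽ᵗ⁾(u, v) = t⁻¹ (u - T t u, v)`, the domain of `𝓔` consists of those `u` for which
`𝓔⁽ᵗ⁾(u, u)` is bounded in `t > 0`, and `𝓔⁽ᵗ⁾ → 𝓔` on it as `t ↓ 0`. -/
structure IsSemigroupOf (T : ℝ → (Lp ℝ 2 μ →L[ℝ] Lp ℝ 2 μ)) : Prop where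
  semigroup : IsSymmSemigroup T
  mem_domain : ∀ u : Lp ℝ 2 μ,
    u ∈ 𝓔.domain ↔ ∃ C : ℝ, ∀ t : ℝ, 0 < t → t⁻¹ * inner ℝ (u - T t u) u ≤ C
  form_eq : ∀ u v : 𝓔.domain,
    Tendsto (fun t : ℝ => t⁻¹ * inner ℝ ((u : Lp ℝ 2 μ) - T t u) (v : Lp ℝ 2 μ))
      (𝓝[>] 0) (𝓝 (𝓔.form u v))

/-- Conservativity of a form over a finite measure: the constant function `1` belongs to the
domain and has zero energy, and the semigroup of the form satisfies `T t 1 = 1`. -/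
def IsConservative : Prop :=
  ∃ e : 𝓔.domain, (∀ᵐ x ∂μ, (e : Lp ℝ 2 μ) x = 1) ∧ 𝓔.form e e = 0 ∧
    ∀ T : ℝ → (Lp ℝ 2 μ →L[ℝ] Lp ℝ 2 μ), 𝓔.IsSemigroupOf T →
      ∀ t : ℝ, 0 ≤ t → T t (e : Lp ℝ 2 μ) = e

end Basic

section Topological

variable {X : Type*} [TopologicalSpace X] [MeasurableSpace X] {μ : Measure X} (𝓔 : L2Form μ)

/-- The support of the measure `|u| μ`: the complement of the largest open set on which `u`
vanishes almost everywhere. -/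
def supp (u : Lp ℝ 2 μ) : Set X :=
  {x | ∀ U : Set X, IsOpen U → x ∈ U → ¬ ∀ᵐ y ∂μ, y ∈ U → u y = 0}

/-- The continuous compactly supported function `f` represents an element of the domain. -/
def Represents (u : 𝓔.domain) (f : C_c(X, ℝ)) : Prop := ∀ᵐ x ∂μ, (u : Lp ℝ 2 μ) x = f x

/-- Regularity: `μ` has full support, and `D(𝓔) ∩ C_c(X)` is `𝓔₁`-dense in `D(𝓔)` and
uniformly dense in `C_c(X)`. -/
structure IsRegular : Prop where
  fullSupport : μ.IsOpenPosMeasure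
  dense_domain : ∀ (u : 𝓔.domain) (ε : ℝ), 0 < ε →
    ∃ (v : 𝓔.domain) (f : C_c(X, ℝ)), 𝓔.Represents v f ∧ 𝓔.energyOne (u - v) < ε
  dense_continuous : ∀ (f : C_c(X, ℝ)) (ε : ℝ), 0 < ε →
    ∃ (v : 𝓔.domain) (g : C_c(X, ℝ)), 𝓔.Represents v g ∧ ∀ x, |f x - g x| < ε

/-- The strong local property: `𝓔(u, v) = 0` whenever `u` and `v` have compact support and
`v` is constant on a neighbourhood of the support of `u`. -/
def IsStronglyLocal : Prop :=
  ∀ u v : 𝓔.domain, IsCompact (supp (u : Lp ℝ 2 μ)) → IsCompact (supp (v : Lp ℝ 2 μ)) →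
    (∃ (U : Set X) (c : ℝ), IsOpen U ∧ supp (u : Lp ℝ 2 μ) ⊆ U ∧
      ∀ᵐ x ∂μ, x ∈ U → (v : Lp ℝ 2 μ) x = c) →
    𝓔.form u v = 0

end Topological

end L2Form

/-! ### Functions on the orthant `[0, ∞)^ι` -/

section Orthant

variable {ι : Type*}

/-- The open orthant `(0, ∞)^ι` inside `[0, ∞)^ι`. -/
def openOrthant (ι : Type*) : Set (ι → ℝ≥0) := {φ | ∀ x, 0 < φ x}

/-- `F` read as a function on `ℝ^ι`; only its values on the open orthant matter below. -/
def lift (F : (ι → ℝ≥0) → ℝ) (u : ι → ℝ) : ℝ := F fun x => (u x).toNNReal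

variable [Fintype ι] [DecidableEq ι]

/-- `C_c^k([0, ∞)^ι)`: continuous functions with compact support that are `k`-times continuously
differentiable in the open orthant and all of whose partial derivatives of order at most `k`
extend continuously to `[0, ∞)^ι`. -/
structure IsCc (k : ℕ) (F : (ι → ℝ≥0) → ℝ) : Prop where
  continuous : Continuous F
  compactSupport : HasCompactSupport F
  contDiffOn : ContDiffOn ℝ k (lift F) {u : ι → ℝ | ∀ x, 0 < u x}
  extends_deriv : ∀ l ≤ k, ∀ v : Fin l → ι, ∃ g : (ι → ℝ≥0) → ℝ, Continuous g ∧
    ∀ φ ∈ openOrthant ι, g φ =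
      iteratedFDeriv ℝ l (lift F) (fun x => (φ x : ℝ)) (fun j => Pi.single (v j) 1)

/-- The partial derivative `∂_x F` on `[0, ∞)^ι`: the continuous extension of the partial
derivative in the open orthant. -/
def pderiv (x : ι) (F : (ι → ℝ≥0) → ℝ) : (ι → ℝ≥0) → ℝ :=
  extendFrom (openOrthant ι)
    fun φ => fderiv ℝ (lift F) (fun y => (φ y : ℝ)) (Pi.single x 1)

end Orthant

/-! ### The lattice, the Hamiltonian and the pinned Gibbs measure -/

/-- Nearest neighbours in `ℤ^d`: Euclidean distance `1`. -/
def Nbr {d : ℕ} (x y : Fin d → ℤ) : Prop := ∑ i, (x i - y i) ^ 2 = 1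

instance {d : ℕ} (x y : Fin d → ℤ) : Decidable (Nbr x y) :=
  inferInstanceAs (Decidable (_ = _))

/-- `D_{d,N} = {1, …, N}^d`. -/
def box (d N : ℕ) : Finset (Fin d → ℤ) := Fintype.piFinset fun _ => Finset.Icc 1 (N : ℤ)

/-- The boundary of `D_{d,N}`: the points outside `D_{d,N}` with a nearest neighbour in
`D_{d,N}`. They all lie in `{0, …, N + 1}^d`; see `mem_boundary`. -/
def boundary (d N : ℕ) : Finset (Fin d → ℤ) :=
  (Fintype.piFinset fun _ => Finset.Icc 0 (N + 1 : ℤ)).filter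
    fun x => x ∉ box d N ∧ ∃ y ∈ box d N, Nbr x y

theorem mem_boundary {d N : ℕ} (x : Fin d → ℤ) :
    x ∈ boundary d N ↔ x ∉ box d N ∧ ∃ y ∈ box d N, Nbr x y := by
  unfold boundary
  rw [Finset.mem_filter, and_iff_right_iff_imp]
  rintro ⟨-, y, hy, hxy⟩
  rw [Fintype.mem_piFinset]
  intro i
  have hyi := Finset.mem_Icc.1 (Fintype.mem_piFinset.1 hy i)
  have h1 : (x i - y i) ^ 2 ≤ 1 := by
    rw [← (show ∑ i, (x i - y i) ^ 2 = 1 from hxy)]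
    exact Finset.single_le_sum (f := fun i => (x i - y i) ^ 2)
      (fun j _ => sq_nonneg _) (Finset.mem_univ i)
  have h2 := abs_le.1 ((sq_le_one_iff_abs_le_one _).1 h1)
  rw [Finset.mem_Icc]
  omega

/-- The closure of `D_{d,N}`. -/
def closedBox (d N : ℕ) : Finset (Fin d → ℤ) := box d N ∪ boundary d N

/-- The space of interfaces `[0, ∞)^{D_{d,N}}`. -/
abbrev Interface (d N : ℕ) : Type := ↥(box d N) → ℝ≥0

/-- The height of an interface, with zero boundary condition. -/
def height {d N : ℕ} (φ : Interface d N) (x : Fin d → ℤ) : ℝ :=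
  if h : x ∈ box d N then (φ ⟨x, h⟩ : ℝ) else 0

/-- The Hamiltonian with pair potential `V` and zero boundary condition. -/
def hamiltonian (d N : ℕ) (V : ℝ → ℝ) (φ : Interface d N) : ℝ :=
  1 / 2 * ∑ x ∈ closedBox d N, ∑ y ∈ (closedBox d N).filter (fun y => Nbr x y),
    V (height φ x - height φ y)

/-- Lebesgue measure on `[0, ∞)`. -/
def halfLineLebesgue : Measure ℝ≥0 := Measure.comap ((↑) : ℝ≥0 → ℝ) volume

/-- The reference measure `∏_x (s δ₀ + dφ_x)` on `[0, ∞)^{D_{d,N}}`. -/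
def refMeasure (d N : ℕ) (s : ℝ) : Measure (Interface d N) :=
  Measure.pi fun _ => ENNReal.ofReal s • Measure.dirac (0 : ℝ≥0) + halfLineLebesgue

/-- The normalizing constant. -/
def partitionFunction (d N : ℕ) (s : ℝ) (V : ℝ → ℝ) : ℝ≥0∞ :=
  ∫⁻ φ, ENNReal.ofReal (Real.exp (-hamiltonian d N V φ)) ∂(refMeasure d N s)

/-- The pinned Gibbs measure. -/
def gibbs (d N : ℕ) (s : ℝ) (V : ℝ → ℝ) : Measure (Interface d N) :=
  (refMeasure d N s).withDensity fun φ =>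
    ENNReal.ofReal (Real.exp (-hamiltonian d N V φ)) / partitionFunction d N s V

/-- The interfaces whose wet region `{x | φ_x > 0}` is exactly `B`. -/
def wet {d N : ℕ} (B : Finset ↥(box d N)) : Set (Interface d N) :=
  {φ | ∀ x, 0 < φ x ↔ x ∈ B}

/-- The restriction `μ_B` of the Gibbs measure to the interfaces with wet region `B`. -/
def gibbsOn (d N : ℕ) (s : ℝ) (V : ℝ → ℝ) (B : Finset ↥(box d N)) :
    Measure (Interface d N) :=
  (gibbs d N s V).restrict (wet B)

/-- The function `𝕍'(x, φ) = ∑_{|x-y|=1} V'(φ_x - φ_y)`. -/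
def potentialDrift (d N : ℕ) (V : ℝ → ℝ) (x : Fin d → ℤ) (φ : Interface d N) : ℝ :=
  ∑ y ∈ (closedBox d N).filter (fun y => Nbr x y), deriv V (height φ x - height φ y)

/-- The assumptions on the pair potential. -/
structure IsPairPotential (d N : ℕ) (s : ℝ) (V : ℝ → ℝ) : Prop where
  bounded_below : ∃ b : ℝ, 0 ≤ b ∧ ∀ r, -b ≤ V r
  contDiff : ContDiff ℝ 1 V
  symm : ∀ r, V (-r) = V r
  integrable : Integrable fun r => Real.exp (-V r)
  drift_memLp : ∀ x ∈ box d N, MemLp (potentialDrift d N V x) 2 (gibbs d N s V)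

/-- The value `∑_{∅ ≠ B ⊆ D_{d,N}} ∑_{x ∈ B} ∫ ∂_x F ∂_x G dμ_B`. -/
def wettingEnergy (d N : ℕ) (s : ℝ) (V : ℝ → ℝ) (F G : Interface d N → ℝ) : ℝ :=
  ∑ B ∈ (Finset.univ : Finset (Finset ↥(box d N))).filter (fun B => B.Nonempty),
    ∑ x ∈ B, ∫ φ, pderiv x F φ * pderiv x G φ ∂(gibbsOn d N s V B)

/-- `𝓔` is the bilinear form on `L²` of the Gibbs measure whose domain is (the set of classes of)
`C_c^2([0, ∞)^{D_{d,N}})` and which is given there by `wettingEnergy`. -/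
structure IsWettingForm (d N : ℕ) (s : ℝ) (V : ℝ → ℝ) (𝓔 : L2Form (gibbs d N s V)) :
    Prop where
  memLp : ∀ F : Interface d N → ℝ, IsCc 2 F → MemLp F 2 (gibbs d N s V)
  mem_domain : ∀ u : Lp ℝ 2 (gibbs d N s V),
    u ∈ 𝓔.domain ↔ ∃ F : Interface d N → ℝ, IsCc 2 F ∧ u =ᵐ[gibbs d N s V] F
  integrable : ∀ F G : Interface d N → ℝ, IsCc 2 F → IsCc 2 G →
    ∀ B : Finset ↥(box d N), ∀ x ∈ B,
      Integrable (fun φ => pderiv x F φ * pderiv x G φ) (gibbsOn d N s V B)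
  form_eq : ∀ F G : Interface d N → ℝ, IsCc 2 F → IsCc 2 G →
    ∀ u v : 𝓔.domain, (u : Lp ℝ 2 (gibbs d N s V)) =ᵐ[gibbs d N s V] F →
      (v : Lp ℝ 2 (gibbs d N s V)) =ᵐ[gibbs d N s V] G →
      𝓔.form u v = wettingEnergy d N s V F G

end Wetting

end

/-!
The form is `⟪∇u, ∇v⟫` for the gradient `∇F = (1_{φ_x > 0} ∂_x F)_x`, an unbounded operator from
`L²(μ)` to a product of copies of `L²(μ)`, so it is enough to close this operator. Integrating
`∂_x F` by parts against test functions that vanish on `{φ_x = 0}` produces no boundary term, and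
the atoms on that face are invisible to them. Dividing such a test function by the density removes
the density from the integral, hence a limit of gradients is a weak gradient of the limit function,
whatever the smoothness of the Hamiltonian: only continuity and positivity of the density matter.
Such a weak gradient vanishes wherever the limit function is constant, which gives closability and
the strong local property at once.

A smooth Lipschitz function operates on the gradient by the chain rule; a general one does so by
approximation and weak compactness in `L²`, which gives the unit contraction. Since `μ` is finite,
slowly varying cutoffs converge to `1` with gradients tending to `0`, and `𝓔(1, 1) = 0` forces
`T_t 1 = 1` because `s ↦ (u - T_s u, u) / s` only increases when `s` is halved.

The normalizing constant is finite because dropping all bonds outside one coordinate direction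
costs a constant factor, and the remaining heights can then be integrated out line by line, starting
at the far end: each one occurs in a single remaining factor, whose integral is bounded uniformly.
-/

noncomputable section

namespace Wetting

section WeakLimits

variable {M α : Type*} [NormedAddCommGroup M] [InnerProductSpace ℝ M]

theorem exists_tendsto_inner_of_norm_le [CompleteSpace M] (U : Ultrafilter α) {z : α → M} {C : ℝ}
    (hz : ∀ a, ‖z a‖ ≤ C) :
    ∃ w : M, ∀ y, Tendsto (fun a => inner ℝ (z a) y) U (𝓝 (inner ℝ w y)) := by
  obtain ⟨L, -, hL⟩ := (WeakDual.isCompact_closedBall (𝕜 := ℝ) (E := M) 0 C).ultrafilter_le_nhds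
    (U.map fun a => StrongDual.toWeakDual (InnerProductSpace.toDual ℝ M (z a)))
    (tendsto_principal.2 (.of_forall fun a => by simpa using hz a))
  refine ⟨(InnerProductSpace.toDual ℝ M).symm (WeakDual.toStrongDual L), fun y => ?_⟩
  rw [InnerProductSpace.toDual_symm_apply]
  exact (WeakDual.eval_continuous y).tendsto L |>.comp hL

variable {l : Filter α} [l.NeBot] {z : α → M} {w : M}

theorem mem_of_tendsto_inner {S : Submodule ℝ M} [S.HasOrthogonalProjection]
    (hzS : ∀ a, z a ∈ S) (hzw : ∀ y, Tendsto (fun a => inner ℝ (z a) y) l (𝓝 (inner ℝ w y))) :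
    w ∈ S := by
  rw [← S.orthogonal_orthogonal]
  refine (Submodule.mem_orthogonal' _ _).2 fun y hy => tendsto_nhds_unique (hzw y) ?_
  exact tendsto_const_nhds.congr fun a => (S.inner_right_of_mem_orthogonal (hzS a) hy).symm

theorem norm_le_of_tendsto_inner {c : α → ℝ} {c₀ : ℝ} (hc : ∀ a, ‖z a‖ ≤ c a)
    (hc₀ : Tendsto c l (𝓝 c₀))
    (hzw : ∀ y, Tendsto (fun a => inner ℝ (z a) y) l (𝓝 (inner ℝ w y))) : ‖w‖ ≤ c₀ := by
  have hsq : ‖w‖ * ‖w‖ ≤ c₀ * ‖w‖ := by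
    rw [← real_inner_self_eq_norm_mul_norm]
    exact le_of_tendsto_of_tendsto' (hzw w) (hc₀.mul_const _) fun a =>
      (real_inner_le_norm _ _).trans (by gcongr; exact hc a)
  rcases (norm_nonneg w).eq_or_lt with h0 | hpos
  · rw [← h0]
    exact ge_of_tendsto' hc₀ fun a => (norm_nonneg _).trans (hc a)
  · exact le_of_mul_le_mul_right hsq hpos

variable {H K : Type*} [NormedAddCommGroup H] [InnerProductSpace ℝ H] [CompleteSpace H]
  [NormedAddCommGroup K] [InnerProductSpace ℝ K] [CompleteSpace K]

theorem exists_mem_norm_le_of_tendsto_fst {Γ : Submodule ℝ (H × K)}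
    (hΓ : IsClosed (Γ : Set (H × K))) {z : ℕ → H × K} (hz : ∀ n, z n ∈ Γ) {u : H}
    (hu : Tendsto (fun n => (z n).1) atTop (𝓝 u)) {c : ℕ → ℝ} {c₀ : ℝ}
    (hc : ∀ n, ‖(z n).2‖ ≤ c n) (hc₀ : Tendsto c atTop (𝓝 c₀)) :
    ∃ g, (u, g) ∈ Γ ∧ ‖g‖ ≤ c₀ := by
  let e : WithLp 2 (H × K) ≃L[ℝ] H × K := WithLp.prodContinuousLinearEquiv 2 ℝ H K
  let Γ₂ : Submodule ℝ (WithLp 2 (H × K)) := Γ.comap (e : WithLp 2 (H × K) →ₗ[ℝ] H × K)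
  have : CompleteSpace Γ₂ :=
    (show IsClosed (Γ₂ : Set (WithLp 2 (H × K))) from hΓ.preimage e.continuous).completeSpace_coe
  let U : Ultrafilter ℕ := Ultrafilter.of atTop
  have hU : (U : Filter ℕ) ≤ atTop := Ultrafilter.of_le atTop
  obtain ⟨R, hR⟩ := (Metric.isBounded_range_of_tendsto _ hc₀).exists_norm_le
  obtain ⟨g, hg⟩ := exists_tendsto_inner_of_norm_le U (z := fun n => (z n).2) (C := R)
    fun n => (hc n).trans ((le_abs_self _).trans (hR _ ⟨n, rfl⟩))
  refine ⟨g, ?_, norm_le_of_tendsto_inner hc (hc₀.mono_left hU) hg⟩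
  suffices h : WithLp.toLp 2 (u, g) ∈ Γ₂ from h
  refine mem_of_tendsto_inner (l := U) (z := fun n => WithLp.toLp 2 (z n)) hz fun y => ?_
  simp only [WithLp.prod_inner_apply]
  exact ((hu.mono_left hU).inner tendsto_const_nhds).add (hg y.snd)

end WeakLimits

namespace L2Form

variable {X : Type*} [MeasurableSpace X] {μ : Measure X}

section Operator

variable {K : Type*} [NormedAddCommGroup K] [InnerProductSpace ℝ K]

/-- The form `(u, v) ↦ ⟪A u, A v⟫` on the domain of an unbounded operator `A`. -/
abbrev ofOperator (A : Lp ℝ 2 μ →ₗ.[ℝ] K) : L2Form μ where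
  domain := A.domain
  form := (innerₗ K).compl₁₂ A.toFun A.toFun

variable {A : Lp ℝ 2 μ →ₗ.[ℝ] K}

theorem ofOperator_form (u v : A.domain) : (ofOperator A).form u v = inner ℝ (A u) (A v) := rfl

theorem ofOperator_form_self (u : A.domain) : (ofOperator A).form u u = ‖A u‖ ^ 2 :=
  real_inner_self_eq_norm_sq _

theorem ofOperator_energyOne_sub (u v : A.domain) :
    (ofOperator A).energyOne (u - v) = ‖A u - A v‖ ^ 2 + ‖(u : Lp ℝ 2 μ) - v‖ ^ 2 := by
  rw [← A.map_sub, ← ofOperator_form_self]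
  rfl

theorem ofOperator_isSymm : (ofOperator A).IsSymm := fun _ _ => real_inner_comm _ _

theorem ofOperator_isPositive : (ofOperator A).IsPositive := fun _ => real_inner_self_nonneg

theorem tendsto_energyOne_sub {ι : Type*} {l : Filter ι} {u v : ι → A.domain} {w : Lp ℝ 2 μ}
    {g : K} (hu : Tendsto (fun i => ((u i : Lp ℝ 2 μ), A (u i))) l (𝓝 (w, g)))
    (hv : Tendsto (fun i => ((v i : Lp ℝ 2 μ), A (v i))) l (𝓝 (w, g))) :
    Tendsto (fun i => (ofOperator A).energyOne (u i - v i)) l (𝓝 0) := by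
  simp only [ofOperator_energyOne_sub]
  simpa using ((hu.snd_nhds.sub hv.snd_nhds).norm.pow 2).add
    ((hu.fst_nhds.sub hv.fst_nhds).norm.pow 2)

theorem cauchySeq_of_tendsto_norm_sub_sq {E : Type*} [NormedAddCommGroup E] {f : ℕ → E}
    (h : Tendsto (fun p : ℕ × ℕ => ‖f p.1 - f p.2‖ ^ 2) atTop (𝓝 0)) : CauchySeq f := by
  rw [cauchySeq_iff_tendsto_dist_atTop_0]
  simpa [Real.sqrt_sq, dist_eq_norm] using h.sqrt

theorem ofOperator_isClosedForm [CompleteSpace K] (hA : A.IsClosed) :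
    (ofOperator A).IsClosedForm := by
  intro u hu
  simp only [ofOperator_energyOne_sub] at hu
  obtain ⟨g, hg⟩ := cauchySeq_tendsto_of_complete (u := fun k => A (u k)) <|
    cauchySeq_of_tendsto_norm_sub_sq (squeeze_zero (fun _ => by positivity)
      (fun p => le_add_of_nonneg_right (by positivity)) hu)
  obtain ⟨v, hv⟩ := cauchySeq_tendsto_of_complete (u := fun k => (u k : Lp ℝ 2 μ)) <|
    cauchySeq_of_tendsto_norm_sub_sq (squeeze_zero (fun _ => by positivity)
      (fun p => le_add_of_nonneg_left (by positivity)) hu)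
  have hvg : (v, g) ∈ A.graph :=
    hA.mem_of_tendsto (hv.prodMk_nhds hg) (.of_forall fun k => A.mem_graph (u k))
  obtain ⟨w, rfl, rfl⟩ := A.mem_graph_iff.1 hvg
  exact ⟨w, tendsto_energyOne_sub (hv.prodMk_nhds hg) tendsto_const_nhds⟩

theorem ofOperator_isClosable [CompleteSpace K] (hA : A.IsClosable) :
    (ofOperator A).IsClosable := by
  intro u hu hu₀
  have hsub (p : ℕ × ℕ) : (ofOperator A).form (u p.1 - u p.2) (u p.1 - u p.2) =
      ‖A (u p.1) - A (u p.2)‖ ^ 2 := by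
    rw [← A.map_sub, ← ofOperator_form_self]
  simp only [IsCauchy, hsub] at hu
  obtain ⟨g, hg⟩ := cauchySeq_tendsto_of_complete (u := fun k => A (u k)) <|
    cauchySeq_of_tendsto_norm_sub_sq hu
  have hg₀ : ((0 : Lp ℝ 2 μ), g) ∈ A.closure.graph := by
    rw [← hA.graph_closure_eq_closure_graph]
    exact mem_closure_of_tendsto (hu₀.prodMk_nhds hg) (.of_forall fun k => A.mem_graph (u k))
  obtain rfl : g = 0 := A.closure.mem_graph_snd_inj hg₀ A.closure.graph.zero_mem rfl
  simpa using hg.norm.pow 2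

theorem ofOperator_closure_isClosureOf [CompleteSpace K] (hA : A.IsClosable) :
    (ofOperator A.closure).IsClosureOf (ofOperator A) := by
  have hle := A.le_closure
  have heq (u : A.domain) : A.closure (Submodule.inclusion hle.1 u) = A u :=
    (hle.2 (x := u) (y := Submodule.inclusion hle.1 u) rfl).symm
  refine ⟨hle.1, fun u v => ?_, ofOperator_isClosedForm hA.closure_isClosed, fun u => ?_⟩
  · rw [ofOperator_form, ofOperator_form, heq, heq]
  · have hu : ((u : Lp ℝ 2 μ), A.closure u) ∈ closure (A.graph : Set (Lp ℝ 2 μ × K)) := by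
      have := A.closure.mem_graph u
      rwa [← hA.graph_closure_eq_closure_graph] at this
    obtain ⟨z, hz, hzu⟩ := mem_closure_iff_seq_limit.1 hu
    choose w hw₁ hw₂ using fun k => A.mem_graph_iff.1 (hz k)
    refine ⟨w, tendsto_energyOne_sub tendsto_const_nhds (hzu.congr fun k => ?_)⟩
    exact Prod.ext (hw₁ k).symm ((hw₂ k).symm.trans (heq _).symm)

end Operator

section Semigroup

variable {T : ℝ → (Lp ℝ 2 μ →L[ℝ] Lp ℝ 2 μ)}

theorem IsSymmSemigroup.inner_sub_two_mul_le (hT : IsSymmSemigroup T) {t : ℝ} (ht : 0 ≤ t)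
    (f : Lp ℝ 2 μ) : inner ℝ (f - T (2 * t) f) f ≤ 2 * inner ℝ (f - T t f) f := by
  have hsymm : inner ℝ (T (2 * t) f) f = inner ℝ (T t f) (T t f) := by
    rw [two_mul, hT.add t t ht ht, hT.symm t ht]
  have hpos : (0 : ℝ) ≤ inner ℝ (f - T t f) (f - T t f) := real_inner_self_nonneg
  have hcomm : inner ℝ f (T t f) = inner ℝ (T t f) f := real_inner_comm _ _
  simp only [inner_sub_left, inner_sub_right] at hpos ⊢
  linarith

theorem IsSymmSemigroup.inner_sub_le_two_pow_mul (hT : IsSymmSemigroup T) {t : ℝ} (ht : 0 ≤ t)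
    (f : Lp ℝ 2 μ) (n : ℕ) :
    inner ℝ (f - T t f) f ≤ 2 ^ n * inner ℝ (f - T (t / 2 ^ n) f) f := by
  induction n with
  | zero => simp
  | succ n ih =>
    have hdouble := hT.inner_sub_two_mul_le (t := t / 2 ^ (n + 1)) (by positivity) f
    rw [show 2 * (t / 2 ^ (n + 1)) = t / 2 ^ n by field_simp; ring] at hdouble
    calc _ ≤ 2 ^ n * inner ℝ (f - T (t / 2 ^ n) f) f := ih
      _ ≤ 2 ^ n * (2 * inner ℝ (f - T (t / 2 ^ (n + 1)) f) f) := by gcongr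
      _ = _ := by ring

theorem IsSymmSemigroup.norm_sub_sq_le (hT : IsSymmSemigroup T) {t : ℝ} (ht : 0 ≤ t)
    (f : Lp ℝ 2 μ) : ‖f - T t f‖ ^ 2 ≤ 2 * inner ℝ (f - T t f) f := by
  have hcontr : ‖T t f‖ ^ 2 ≤ ‖f‖ ^ 2 := by gcongr; exact hT.contraction t ht f
  rw [norm_sub_sq_real, inner_sub_left, real_inner_self_eq_norm_sq, real_inner_comm]
  linarith

variable {𝓔 : L2Form μ}

theorem IsSemigroupOf.inner_sub_le_mul_form (hT : 𝓔.IsSemigroupOf T) (u : 𝓔.domain) {t : ℝ}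
    (ht : 0 < t) : inner ℝ ((u : Lp ℝ 2 μ) - T t u) (u : Lp ℝ 2 μ) ≤ t * 𝓔.form u u := by
  have hseq : Tendsto (fun n : ℕ => t / 2 ^ n) atTop (𝓝[>] 0) :=
    tendsto_nhdsWithin_iff.2 ⟨tendsto_const_nhds.div_atTop
      (tendsto_pow_atTop_atTop_of_one_lt one_lt_two), .of_forall fun n => mem_Ioi.2 (by positivity)⟩
  refine ge_of_tendsto' (((hT.form_eq u u).comp hseq).const_mul t) fun n =>
    (hT.semigroup.inner_sub_le_two_pow_mul ht.le _ n).trans_eq ?_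
  simp only [Function.comp_apply]
  field_simp

theorem IsSemigroupOf.apply_eq_self (hT : 𝓔.IsSemigroupOf T) {e : 𝓔.domain}
    (he : 𝓔.form e e = 0) {t : ℝ} (ht : 0 ≤ t) : T t (e : Lp ℝ 2 μ) = e := by
  rcases ht.eq_or_lt with rfl | ht
  · exact hT.semigroup.zero _
  have hsq := hT.semigroup.norm_sub_sq_le ht.le (e : Lp ℝ 2 μ)
  have hle := hT.inner_sub_le_mul_form e ht
  rw [he, mul_zero] at hle
  have h0 : ‖(e : Lp ℝ 2 μ) - T t e‖ = 0 :=
    pow_eq_zero_iff two_ne_zero |>.1 (le_antisymm (by linarith) (by positivity))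
  exact (sub_eq_zero.1 (norm_eq_zero.1 h0)).symm

end Semigroup

end L2Form

/-! ### Calculus on the orthant -/

theorem iteratedFDeriv_two_comp_apply {E : Type*} [NormedAddCommGroup E] [NormedSpace ℝ E]
    {f : E → ℝ} {u : E} (hf : ContDiffAt ℝ 2 f u) {j : ℝ → ℝ} (hj : ContDiff ℝ 2 j)
    (v : Fin 2 → E) :
    iteratedFDeriv ℝ 2 (j ∘ f) u v = deriv j (f u) * iteratedFDeriv ℝ 2 f u v +
      deriv (deriv j) (f u) * fderiv ℝ f u (v 0) * fderiv ℝ f u (v 1) := by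
  have hj' : ContDiff ℝ 1 (deriv j) :=
    (contDiff_succ_iff_deriv (n := 1).1 (by simpa [one_add_one_eq_two] using hj)).2.2
  have hchain : fderiv ℝ (j ∘ f) =ᶠ[𝓝 u] fun w => deriv j (f w) • fderiv ℝ f w := by
    filter_upwards [hf.eventually (by simp)] with w hw
    exact ((hj.differentiable two_ne_zero (f w)).hasDerivAt.comp_hasFDerivAt w
      (hw.differentiableAt two_ne_zero).hasFDerivAt).fderiv
  have hfirst : HasFDerivAt (fun w => deriv j (f w)) (deriv (deriv j) (f u) • fderiv ℝ f u) u :=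
    (hj'.differentiable one_ne_zero (f u)).hasDerivAt.comp_hasFDerivAt u
      (hf.differentiableAt two_ne_zero).hasFDerivAt
  have hsecond : HasFDerivAt (fderiv ℝ f) (fderiv ℝ (fderiv ℝ f) u) u :=
    ((hf.fderiv_right (m := 1) (by simp [one_add_one_eq_two])).differentiableAt
      one_ne_zero).hasFDerivAt
  rw [iteratedFDeriv_two_apply, iteratedFDeriv_two_apply, hchain.fderiv_eq,
    show fderiv ℝ (fun w => deriv j (f w) • fderiv ℝ f w) u = _ from
      (hfirst.smul hsecond).fderiv]
  simp only [add_apply, smul_apply, ContinuousLinearMap.smulRight_apply, smul_eq_mul]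

section OrthantCalculus

variable {ι : Type*}

/-- The inclusion `[0, ∞)^ι ⊆ ℝ^ι`. -/
def emb (φ : ι → ℝ≥0) : ι → ℝ := fun x => (φ x : ℝ)

/-- The retraction of `ℝ^ι` onto `[0, ∞)^ι`, so that `lift F = F ∘ retr`. -/
def retr (u : ι → ℝ) : ι → ℝ≥0 := fun x => (u x).toNNReal

theorem retr_emb (φ : ι → ℝ≥0) : retr (emb φ) = φ := by
  funext x; simp [retr, emb]

theorem lift_emb (F : (ι → ℝ≥0) → ℝ) (φ : ι → ℝ≥0) : lift F (emb φ) = F φ :=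
  congrArg F (retr_emb φ)

theorem emb_retr {u : ι → ℝ} (hu : ∀ x, 0 < u x) : emb (retr u) = u := by
  funext x; simp [retr, emb, (hu x).le]

theorem continuous_emb : Continuous (emb : (ι → ℝ≥0) → ι → ℝ) := by
  unfold emb; fun_prop

theorem continuous_retr : Continuous (retr : (ι → ℝ) → ι → ℝ≥0) := by
  unfold retr; fun_prop

theorem isClosedEmbedding_emb : IsClosedEmbedding (emb : (ι → ℝ≥0) → ι → ℝ) :=
  (show Function.LeftInverse retr emb from retr_emb).isClosedEmbedding continuous_retr
    continuous_emb

theorem emb_pos {φ : ι → ℝ≥0} (hφ : φ ∈ openOrthant ι) (x : ι) : 0 < emb φ x :=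
  NNReal.coe_pos.2 (hφ x)

theorem dense_openOrthant : Dense (openOrthant ι) := by
  have hpi : openOrthant ι = Set.pi univ fun _ => Ioi (0 : ℝ≥0) := by
    ext φ; simp [openOrthant]
  rw [hpi]
  refine dense_pi _ fun x _ => ?_
  rw [dense_iff_closure_eq, closure_Ioi]
  exact Ici_bot

theorem eventually_pos [Finite ι] {u : ι → ℝ} (hu : ∀ x, 0 < u x) : ∀ᶠ w in 𝓝 u, ∀ x, 0 < w x :=
  eventually_all.2 fun x => (continuous_apply x).continuousAt.eventually_const_lt (hu x)

theorem lift_comp_emb_eventuallyEq [Finite ι] (f : (ι → ℝ) → ℝ) {u : ι → ℝ} (hu : ∀ x, 0 < u x) :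
    lift (fun φ => f (emb φ)) =ᶠ[𝓝 u] f := by
  filter_upwards [eventually_pos hu] with w hw
  exact congrArg f (emb_retr hw)

variable [DecidableEq ι]

theorem emb_update (φ : ι → ℝ≥0) (x : ι) {t : ℝ} (ht : 0 ≤ t) :
    emb (Function.update φ x t.toNNReal) = Function.update (emb φ) x t := by
  funext y
  rcases eq_or_ne y x with rfl | h
  · simp [emb, ht]
  · simp [emb, h]

theorem update_mem_openOrthant {φ : ι → ℝ≥0} (hφ : φ ∈ openOrthant ι) (x : ι) {t : ℝ}
    (ht : 0 < t) : Function.update φ x t.toNNReal ∈ openOrthant ι :=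
  (Function.forall_update_iff φ fun _ r => 0 < r).2 ⟨by simpa using ht, fun y _ => hφ y⟩

theorem pderiv_eq {F g : (ι → ℝ≥0) → ℝ} {x : ι} (hg : Continuous g)
    (h : ∀ φ ∈ openOrthant ι, g φ = fderiv ℝ (lift F) (emb φ) (Pi.single x 1)) :
    pderiv x F = g := by
  funext φ
  refine extendFrom_eq (dense_openOrthant φ) ((hg.tendsto φ).mono_left nhdsWithin_le_nhds
    |>.congr' ?_)
  filter_upwards [self_mem_nhdsWithin] with ψ hψ using h ψ hψ

variable [Fintype ι]

theorem pderiv_comp_emb {f : (ι → ℝ) → ℝ} (hf : ContDiff ℝ 1 f) (x : ι) :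
    pderiv x (fun φ => f (emb φ)) = fun φ => fderiv ℝ f (emb φ) (Pi.single x 1) :=
  pderiv_eq (((hf.continuous_fderiv one_ne_zero).comp continuous_emb).clm_apply continuous_const)
    fun φ hφ => by rw [(lift_comp_emb_eventuallyEq f (emb_pos hφ)).fderiv_eq]

namespace IsCc

variable {k : ℕ} {F G : (ι → ℝ≥0) → ℝ}

theorem contDiffAt (hF : IsCc k F) {φ : ι → ℝ≥0} (hφ : φ ∈ openOrthant ι) :
    ContDiffAt ℝ k (lift F) (emb φ) :=
  hF.contDiffOn.contDiffAt (eventually_pos (emb_pos hφ))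

theorem differentiableAt (hF : IsCc k F) (hk : k ≠ 0) {φ : ι → ℝ≥0} (hφ : φ ∈ openOrthant ι) :
    DifferentiableAt ℝ (lift F) (emb φ) :=
  (hF.contDiffAt hφ).differentiableAt (mod_cast hk)

theorem continuous_pderiv_and_eqOn (hF : IsCc k F) (hk : k ≠ 0) (x : ι) :
    Continuous (pderiv x F) ∧
      EqOn (pderiv x F) (fun φ => fderiv ℝ (lift F) (emb φ) (Pi.single x 1)) (openOrthant ι) := by
  obtain ⟨g, hg, h⟩ := hF.extends_deriv 1 (Nat.one_le_iff_ne_zero.2 hk) fun _ => x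
  have hfderiv : ∀ φ ∈ openOrthant ι, g φ = fderiv ℝ (lift F) (emb φ) (Pi.single x 1) :=
    fun φ hφ => (h φ hφ).trans (iteratedFDeriv_one_apply _)
  rw [pderiv_eq hg hfderiv]
  exact ⟨hg, hfderiv⟩

theorem continuous_pderiv (hF : IsCc k F) (hk : k ≠ 0) (x : ι) : Continuous (pderiv x F) :=
  (hF.continuous_pderiv_and_eqOn hk x).1

theorem pderiv_apply (hF : IsCc k F) (hk : k ≠ 0) (x : ι) {φ : ι → ℝ≥0}
    (hφ : φ ∈ openOrthant ι) : pderiv x F φ = fderiv ℝ (lift F) (emb φ) (Pi.single x 1) :=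
  (hF.continuous_pderiv_and_eqOn hk x).2 hφ

theorem tsupport_pderiv_subset (hF : IsCc k F) (hk : k ≠ 0) (x : ι) :
    tsupport (pderiv x F) ⊆ tsupport F := by
  have hU : IsOpen (tsupport F)ᶜ := (isClosed_tsupport F).isOpen_compl
  refine closure_minimal (fun φ hφ => ?_) (isClosed_tsupport F)
  by_contra hn
  obtain ⟨ψ, ⟨hψ, hψU⟩, hψO⟩ := dense_openOrthant.inter_open_nonempty _
    (((hF.continuous_pderiv hk x).isOpen_support).inter hU) ⟨φ, hφ, hn⟩
  have hzero : lift F =ᶠ[𝓝 (emb ψ)] fun _ => 0 := by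
    filter_upwards [(hU.preimage continuous_retr).mem_nhds
      (show retr (emb ψ) ∈ (tsupport F)ᶜ by rwa [retr_emb])] with u hu
    exact image_eq_zero_of_notMem_tsupport (f := F) hu
  refine hψ ?_
  rw [hF.pderiv_apply hk x hψO, hzero.fderiv_eq]
  simp

theorem hasCompactSupport_pderiv (hF : IsCc k F) (hk : k ≠ 0) (x : ι) :
    HasCompactSupport (pderiv x F) :=
  hF.compactSupport.of_isClosed_subset (isClosed_tsupport _) (hF.tsupport_pderiv_subset hk x)

theorem add (hF : IsCc k F) (hG : IsCc k G) : IsCc k (F + G) where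
  continuous := hF.continuous.add hG.continuous
  compactSupport := hF.compactSupport.add hG.compactSupport
  contDiffOn := hF.contDiffOn.add hG.contDiffOn
  extends_deriv l hl v := by
    obtain ⟨f, hf, hf'⟩ := hF.extends_deriv l hl v
    obtain ⟨g, hg, hg'⟩ := hG.extends_deriv l hl v
    refine ⟨f + g, hf.add hg, fun φ hφ => ?_⟩
    have hl' : (l : WithTop ℕ∞) ≤ k := mod_cast hl
    change f φ + g φ = iteratedFDeriv ℝ l (lift F + lift G) (emb φ) _
    rw [iteratedFDeriv_add_apply ((hF.contDiffAt hφ).of_le hl') ((hG.contDiffAt hφ).of_le hl'),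
      hf' φ hφ, hg' φ hφ]
    rfl

theorem const_smul (hF : IsCc k F) (c : ℝ) : IsCc k (c • F) where
  continuous := hF.continuous.const_smul c
  compactSupport := hF.compactSupport.smul_left (f := fun _ => c)
  contDiffOn := contDiffOn_const.smul hF.contDiffOn
  extends_deriv l hl v := by
    obtain ⟨f, hf, hf'⟩ := hF.extends_deriv l hl v
    refine ⟨c • f, hf.const_smul c, fun φ hφ => ?_⟩
    change c • f φ = iteratedFDeriv ℝ l (c • lift F) (emb φ) _
    rw [iteratedFDeriv_const_smul_apply ((hF.contDiffAt hφ).of_le (mod_cast hl)), hf' φ hφ]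
    rfl

theorem comp_emb {f : (ι → ℝ) → ℝ} (hf : ContDiff ℝ k f) (hc : HasCompactSupport f) :
    IsCc k (fun φ => f (emb φ)) where
  continuous := hf.continuous.comp continuous_emb
  compactSupport := hc.comp_isClosedEmbedding isClosedEmbedding_emb
  contDiffOn := hf.contDiffOn.congr fun _ hu => congrArg f (emb_retr hu)
  extends_deriv l hl v := by
    refine ⟨fun φ => iteratedFDeriv ℝ l f (emb φ) fun j => Pi.single (v j) 1, ?_, fun φ hφ => ?_⟩
    · exact (ContinuousMultilinearMap.apply ℝ (fun _ : Fin l => ι → ℝ) ℝ _).continuous.comp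
        ((hf.continuous_iteratedFDeriv (mod_cast hl)).comp continuous_emb)
    · exact congrArg (· fun j => Pi.single (v j) 1)
        ((lift_comp_emb_eventuallyEq f (emb_pos hφ)).iteratedFDeriv ℝ l).eq_of_nhds.symm

theorem zero : IsCc k (0 : (ι → ℝ≥0) → ℝ) :=
  comp_emb (f := 0) contDiff_const HasCompactSupport.zero

theorem pderiv_add (hF : IsCc k F) (hG : IsCc k G) (hk : k ≠ 0) (x : ι) :
    pderiv x (F + G) = pderiv x F + pderiv x G := by
  refine pderiv_eq ((hF.continuous_pderiv hk x).add (hG.continuous_pderiv hk x)) fun φ hφ => ?_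
  change _ = fderiv ℝ (lift F + lift G) (emb φ) _
  rw [fderiv_add (hF.differentiableAt hk hφ) (hG.differentiableAt hk hφ), Pi.add_apply,
    hF.pderiv_apply hk x hφ, hG.pderiv_apply hk x hφ]
  rfl

theorem pderiv_const_smul (hF : IsCc k F) (hk : k ≠ 0) (c : ℝ) (x : ι) :
    pderiv x (c • F) = c • pderiv x F := by
  refine pderiv_eq ((hF.continuous_pderiv hk x).const_smul c) fun φ hφ => ?_
  change _ = fderiv ℝ (c • lift F) (emb φ) _
  rw [fderiv_const_smul (hF.differentiableAt hk hφ), Pi.smul_apply, hF.pderiv_apply hk x hφ]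
  rfl

theorem fderiv_lift_comp (hF : IsCc k F) (hk : k ≠ 0) {j : ℝ → ℝ} (hj : ContDiff ℝ 1 j)
    {φ : ι → ℝ≥0} (hφ : φ ∈ openOrthant ι) :
    fderiv ℝ (lift (j ∘ F)) (emb φ) = deriv j (F φ) • fderiv ℝ (lift F) (emb φ) := by
  have hchain := (hj.differentiable one_ne_zero (lift F (emb φ))).hasDerivAt.comp_hasFDerivAt
    (emb φ) (hF.differentiableAt hk hφ).hasFDerivAt
  rw [lift_emb] at hchain
  exact hchain.fderiv

theorem pderiv_comp (hF : IsCc k F) (hk : k ≠ 0) {j : ℝ → ℝ} (hj : ContDiff ℝ 1 j) (x : ι) :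
    pderiv x (j ∘ F) = fun φ => deriv j (F φ) * pderiv x F φ := by
  refine pderiv_eq (((hj.continuous_deriv le_rfl).comp hF.continuous).mul
    (hF.continuous_pderiv hk x)) fun φ hφ => ?_
  rw [hF.fderiv_lift_comp hk hj hφ, hF.pderiv_apply hk x hφ]
  rfl

theorem comp (hF : IsCc 2 F) {j : ℝ → ℝ} (hj : ContDiff ℝ 2 j) (h0 : j 0 = 0) :
    IsCc 2 (j ∘ F) where
  continuous := hj.continuous.comp hF.continuous
  compactSupport := hF.compactSupport.comp_left h0
  contDiffOn := hj.comp_contDiffOn hF.contDiffOn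
  extends_deriv l hl v := by
    have hj' : ContDiff ℝ 1 (deriv j) :=
      (contDiff_succ_iff_deriv (n := 1).1 (by simpa [one_add_one_eq_two] using hj)).2.2
    have hF' (i : ι) : Continuous (pderiv i F) := hF.continuous_pderiv two_ne_zero i
    interval_cases l
    · exact ⟨j ∘ F, hj.continuous.comp hF.continuous, fun φ _ => (lift_emb (j ∘ F) φ).symm⟩
    · refine ⟨fun φ => deriv j (F φ) * pderiv (v 0) F φ,
        (hj'.continuous.comp hF.continuous).mul (hF' _), fun φ hφ => ?_⟩
      change deriv j (F φ) * _ = _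
      rw [iteratedFDeriv_one_apply, hF.pderiv_apply two_ne_zero _ hφ]
      exact (DFunLike.congr_fun (hF.fderiv_lift_comp two_ne_zero (hj.of_le one_le_two) hφ) _).symm
    · obtain ⟨g, hg, hg'⟩ := hF.extends_deriv 2 le_rfl v
      refine ⟨fun φ => deriv j (F φ) * g φ +
        deriv (deriv j) (F φ) * pderiv (v 0) F φ * pderiv (v 1) F φ, ?_, fun φ hφ => ?_⟩
      · have := hj'.continuous.comp hF.continuous
        have := (hj'.continuous_deriv le_rfl).comp hF.continuous
        exact .add (.mul ‹_› hg) (.mul (.mul ‹_› (hF' _)) (hF' _))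
      · change deriv j (F φ) * g φ + _ = iteratedFDeriv ℝ 2 (j ∘ lift F) (emb φ) _
        rw [iteratedFDeriv_two_comp_apply (hF.contDiffAt hφ) hj, lift_emb, hg' φ hφ,
          hF.pderiv_apply two_ne_zero _ hφ, hF.pderiv_apply two_ne_zero _ hφ]
        rfl

theorem hasDerivAt_of_mem_openOrthant (hF : IsCc k F) (hk : k ≠ 0) (x : ι) {φ : ι → ℝ≥0}
    (hφ : φ ∈ openOrthant ι) {t : ℝ} (ht : 0 < t) :
    HasDerivAt (fun t : ℝ => F (Function.update φ x t.toNNReal))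
      (pderiv x F (Function.update φ x t.toNNReal)) t := by
  have hline : (fun t : ℝ => F (Function.update φ x t.toNNReal)) =ᶠ[𝓝 t]
      lift F ∘ Function.update (emb φ) x := by
    filter_upwards [lt_mem_nhds ht] with r hr
    rw [Function.comp_apply, ← emb_update φ x hr.le, lift_emb]
  have hφt := update_mem_openOrthant hφ x ht
  have hfderiv := (hF.differentiableAt hk hφt).hasFDerivAt
  rw [hF.pderiv_apply hk x hφt]
  rw [emb_update φ x ht.le] at hfderiv ⊢
  exact (hfderiv.comp_hasDerivAt t (hasDerivAt_update (𝕜 := ℝ) (emb φ) x t)).congr_of_eventuallyEq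
    hline

theorem integral_pderiv (hF : IsCc k F) (hk : k ≠ 0) (x : ι) {a b : ℝ} (ha : 0 < a) (hb : 0 < b)
    (φ : ι → ℝ≥0) : ∫ t in a..b, pderiv x F (Function.update φ x t.toNNReal) =
      F (Function.update φ x b.toNNReal) - F (Function.update φ x a.toNNReal) := by
  have hF₀ := hF.continuous
  have hF₁ := hF.continuous_pderiv hk x
  have hcl : IsClosed {φ : ι → ℝ≥0 | ∫ t in a..b, pderiv x F (Function.update φ x t.toNNReal) =
      F (Function.update φ x b.toNNReal) - F (Function.update φ x a.toNNReal)} :=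
    isClosed_eq (intervalIntegral.continuous_parametric_intervalIntegral_of_continuous'
      (by fun_prop) a b) (by fun_prop)
  refine closure_minimal (fun φ hφ => ?_) hcl (dense_openOrthant φ)
  exact intervalIntegral.integral_eq_sub_of_hasDerivAt
    (fun t ht => hF.hasDerivAt_of_mem_openOrthant hk x hφ ((lt_min ha hb).trans_le ht.1))
    ((by fun_prop : Continuous _).intervalIntegrable _ _)

-- On the faces `lift F` need not be differentiable, hence the detour through `integral_pderiv`.
theorem hasDerivAt (hF : IsCc k F) (hk : k ≠ 0) (x : ι) (φ : ι → ℝ≥0) {t : ℝ} (ht : 0 < t) :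
    HasDerivAt (fun t : ℝ => F (Function.update φ x t.toNNReal))
      (pderiv x F (Function.update φ x t.toNNReal)) t := by
  have hF₁ := hF.continuous_pderiv hk x
  have hc : Continuous fun t : ℝ => pderiv x F (Function.update φ x t.toNNReal) := by fun_prop
  refine ((intervalIntegral.integral_hasDerivAt_right (hc.intervalIntegrable t t)
    (hc.stronglyMeasurableAtFilter _ _) hc.continuousAt).const_add
      (F (Function.update φ x t.toNNReal))).congr_of_eventuallyEq ?_
  filter_upwards [lt_mem_nhds ht] with r hr
  rw [hF.integral_pderiv hk x ht hr φ]
  ring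

end IsCc

end OrthantCalculus

/-! ### The reference measure -/

section SiteMeasure

theorem measurableEmbedding_nnreal_coe : MeasurableEmbedding ((↑) : ℝ≥0 → ℝ) :=
  (isClosed_Ici (a := (0 : ℝ))).isClosedEmbedding_subtypeVal.measurableEmbedding

theorem map_halfLineLebesgue :
    halfLineLebesgue.map ((↑) : ℝ≥0 → ℝ) = volume.restrict (Ici 0) := by
  rw [halfLineLebesgue, measurableEmbedding_nnreal_coe.map_comap]
  exact congrArg _ Subtype.range_coe

instance : IsFiniteMeasureOnCompacts halfLineLebesgue :=
  IsFiniteMeasureOnCompacts.comap' _ NNReal.continuous_coe measurableEmbedding_nnreal_coe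

instance : halfLineLebesgue.IsOpenPosMeasure where
  open_pos U hU hne := by
    have hdense : Dense (Ioi (0 : ℝ≥0)) := by
      rw [dense_iff_closure_eq, closure_Ioi]
      exact Ici_bot
    obtain ⟨r, hrU, hr⟩ := hdense.inter_open_nonempty U hU hne
    have hopen : IsOpen (Ioi (0 : ℝ) ∩ Real.toNNReal ⁻¹' U) :=
      isOpen_Ioi.inter (hU.preimage continuous_real_toNNReal)
    have hsub : Ioi (0 : ℝ) ∩ Real.toNNReal ⁻¹' U ⊆ ((↑) : ℝ≥0 → ℝ) '' U := by
      rintro t ⟨ht, htU⟩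
      exact ⟨t.toNNReal, htU, Real.coe_toNNReal t (mem_Ioi.1 ht).le⟩
    rw [halfLineLebesgue, measurableEmbedding_nnreal_coe.comap_apply]
    exact ((hopen.measure_pos volume ⟨r, NNReal.coe_pos.2 hr, by simpa using hrU⟩).trans_le
      (measure_mono hsub)).ne'

/-- The single-site reference measure `s δ₀ + dt` on `[0, ∞)`. -/
def siteMeasure (s : ℝ) : Measure ℝ≥0 :=
  ENNReal.ofReal s • Measure.dirac (0 : ℝ≥0) + halfLineLebesgue

instance (s : ℝ) : IsFiniteMeasureOnCompacts (siteMeasure s) where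
  lt_top_of_isCompact K hK := by
    rw [siteMeasure, Measure.add_apply, Measure.smul_apply, smul_eq_mul]
    exact ENNReal.add_lt_top.2 ⟨ENNReal.mul_lt_top ENNReal.ofReal_lt_top (measure_lt_top _ _),
      hK.measure_lt_top⟩

instance (s : ℝ) : (siteMeasure s).IsOpenPosMeasure where
  open_pos U hU hne := by
    rw [siteMeasure, Measure.add_apply]
    exact ((hU.measure_pos halfLineLebesgue hne).trans_le le_add_self).ne'

theorem setIntegral_Ioi_siteMeasure (s : ℝ) (h : ℝ≥0 → ℝ) :
    ∫ t in Ioi 0, h t ∂(siteMeasure s) = ∫ t in Ioi (0 : ℝ), h t.toNNReal := by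
  have hIoi : ((↑) : ℝ≥0 → ℝ) ⁻¹' Ioi 0 = Ioi 0 := by ext; simp
  have hrestrict : (siteMeasure s).restrict (Ioi 0) = halfLineLebesgue.restrict (Ioi 0) := by
    rw [siteMeasure, Measure.restrict_add, Measure.restrict_smul,
      Measure.restrict_eq_zero.2 (by simp : Measure.dirac (0 : ℝ≥0) (Ioi 0) = 0), smul_zero,
      zero_add]
  have hmap := measurableEmbedding_nnreal_coe.setIntegral_map (μ := halfLineLebesgue)
    (fun t : ℝ => h t.toNNReal) (Ioi 0)
  rw [map_halfLineLebesgue, Measure.restrict_restrict measurableSet_Ioi,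
    inter_eq_left.2 Ioi_subset_Ici_self, hIoi] at hmap
  simpa only [hrestrict, Real.toNNReal_coe] using hmap.symm

theorem setIntegral_Ioi_siteMeasure_eq_zero_of_hasDerivAt (s : ℝ) {g g' : ℝ≥0 → ℝ}
    (hg : Continuous g) (hg' : Continuous g') (hcg : HasCompactSupport g)
    (hcg' : HasCompactSupport g') (h0 : g 0 = 0)
    (hd : ∀ t : ℝ, 0 < t → HasDerivAt (fun t : ℝ => g t.toNNReal) (g' t.toNNReal) t) :
    ∫ t in Ioi 0, g' t ∂(siteMeasure s) = 0 := by
  have hint : IntegrableOn (fun t : ℝ => g' t.toNNReal) (Ici 0) := by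
    rw [IntegrableOn, ← map_halfLineLebesgue, measurableEmbedding_nnreal_coe.integrable_map_iff]
    exact (hg'.integrable_of_hasCompactSupport hcg').congr (.of_forall fun t => by simp)
  have hlim : Tendsto (fun t : ℝ => g t.toNNReal) atTop (𝓝 0) :=
    (hcg.is_zero_at_infty.mono_left atTop_le_cocompact).comp tendsto_real_toNNReal_atTop
  rw [setIntegral_Ioi_siteMeasure, integral_Ioi_of_hasDerivAt_of_tendsto
    (hg.comp continuous_real_toNNReal).continuousWithinAt hd
    (hint.mono_set Ioi_subset_Ici_self) hlim]
  simp [h0]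

end SiteMeasure

theorem lintegral_ofReal_eq_of_integral_eq_zero {α : Type*} [MeasurableSpace α] {m : Measure α}
    {f : α → ℝ} (hf : Integrable f m) (h : ∫ a, f a ∂m = 0) :
    ∫⁻ a, ENNReal.ofReal (f a) ∂m = ∫⁻ a, ENNReal.ofReal (-f a) ∂m := by
  rw [integral_eq_lintegral_pos_part_sub_lintegral_neg_part hf, sub_eq_zero] at h
  exact (ENNReal.toReal_eq_toReal_iff' hf.lintegral_lt_top.ne hf.neg.lintegral_lt_top.ne).1 h

theorem integral_pi_eq_zero_of_integral_update_eq_zero {ι : Type*} [Fintype ι] [DecidableEq ι]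
    {X : ι → Type*} [∀ i, MeasurableSpace (X i)] {m : ∀ i, Measure (X i)} [∀ i, SigmaFinite (m i)]
    {f : (∀ i, X i) → ℝ} (hf : Integrable f (Measure.pi m)) (hfm : Measurable f) (x : ι)
    (hint : ∀ φ, Integrable (fun t => f (Function.update φ x t)) (m x))
    (hzero : ∀ φ, ∫ t, f (Function.update φ x t) ∂(m x) = 0) : ∫ φ, f φ ∂(Measure.pi m) = 0 := by
  rw [integral_eq_lintegral_pos_part_sub_lintegral_neg_part hf, sub_eq_zero]
  refine congrArg ENNReal.toReal
    (lintegral_eq_of_lmarginal_eq {x} hfm.ennreal_ofReal hfm.neg.ennreal_ofReal ?_)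
  rw [lmarginal_singleton, lmarginal_singleton]
  exact funext fun φ => lintegral_ofReal_eq_of_integral_eq_zero (hint φ) (hzero φ)

section Reference

variable {ι : Type*}

/-- The set `{φ_x > 0}` of interfaces that are not pinned at `x`. -/
def posSet (x : ι) : Set (ι → ℝ≥0) := {φ | 0 < φ x}

theorem isOpen_posSet (x : ι) : IsOpen (posSet x) :=
  isOpen_lt continuous_const (continuous_apply x)

theorem measurableSet_posSet [Countable ι] (x : ι) : MeasurableSet (posSet x) :=
  (isOpen_posSet x).measurableSet

theorem isClosedEmbedding_update [DecidableEq ι] (φ : ι → ℝ≥0) (x : ι) :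
    IsClosedEmbedding fun t : ℝ≥0 => Function.update φ x t :=
  (show Function.LeftInverse (fun ψ : ι → ℝ≥0 => ψ x) (fun t : ℝ≥0 => Function.update φ x t) from
    fun t => by simp).isClosedEmbedding (continuous_apply x)
      (continuous_const.update x continuous_id)

variable [Fintype ι]

/-- The reference measure `∏_x (s δ₀ + dφ_x)` on `[0, ∞)^ι`; see `refMeasure`. -/
def piRef (ι : Type*) [Fintype ι] (s : ℝ) : Measure (ι → ℝ≥0) := Measure.pi fun _ => siteMeasure s

instance (s : ℝ) : IsLocallyFiniteMeasure (piRef ι s) := by unfold piRef; infer_instance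

instance (s : ℝ) : (piRef ι s).IsOpenPosMeasure := by unfold piRef; infer_instance

variable [DecidableEq ι]

theorem setIntegral_posSet_eq_zero_of_hasDerivAt (s : ℝ) (x : ι) {G G' : (ι → ℝ≥0) → ℝ}
    (hG : Continuous G) (hG' : Continuous G') (hcG : HasCompactSupport G)
    (hcG' : HasCompactSupport G') (h0 : ∀ φ, φ x = 0 → G φ = 0)
    (hd : ∀ φ, ∀ t : ℝ, 0 < t → HasDerivAt (fun t : ℝ => G (Function.update φ x t.toNNReal))
      (G' (Function.update φ x t.toNNReal)) t) :
    ∫ φ in posSet x, G' φ ∂(piRef ι s) = 0 := by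
  have hline (φ : ι → ℝ≥0) : (fun t => (posSet x).indicator G' (Function.update φ x t)) =
      (Ioi 0).indicator fun t => G' (Function.update φ x t) := by
    funext t
    simp only [indicator_apply, posSet, mem_ofPred_eq, Function.update_self, mem_Ioi]
  have hfibre {f : (ι → ℝ≥0) → ℝ} (hf : HasCompactSupport f) (φ : ι → ℝ≥0) :
      HasCompactSupport fun t => f (Function.update φ x t) :=
    hf.comp_isClosedEmbedding (isClosedEmbedding_update φ x)
  rw [← integral_indicator (measurableSet_posSet x)]
  refine integral_pi_eq_zero_of_integral_update_eq_zero
    ((hG'.integrable_of_hasCompactSupport hcG').indicator (measurableSet_posSet x))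
    (hG'.measurable.indicator (measurableSet_posSet x)) x (fun φ => ?_) fun φ => ?_
  · rw [hline]
    exact (Continuous.integrable_of_hasCompactSupport (by fun_prop) (hfibre hcG' φ)).indicator
      measurableSet_Ioi
  · rw [hline, integral_indicator measurableSet_Ioi]
    exact setIntegral_Ioi_siteMeasure_eq_zero_of_hasDerivAt s
      (g := fun t => G (Function.update φ x t))
      (by fun_prop) (by fun_prop) (hfibre hcG φ) (hfibre hcG' φ) (h0 _ (by simp)) (hd φ)

variable {k l : ℕ} {F Ψ : (ι → ℝ≥0) → ℝ}

theorem IsCc.setIntegral_pderiv_eq_zero (hΨ : IsCc k Ψ) (hk : k ≠ 0) (s : ℝ) {x : ι}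
    (h0 : ∀ φ, φ x = 0 → Ψ φ = 0) : ∫ φ in posSet x, pderiv x Ψ φ ∂(piRef ι s) = 0 :=
  setIntegral_posSet_eq_zero_of_hasDerivAt s x hΨ.continuous (hΨ.continuous_pderiv hk x)
    hΨ.compactSupport (hΨ.hasCompactSupport_pderiv hk x) h0 fun φ _ ht => hΨ.hasDerivAt hk x φ ht

theorem IsCc.setIntegral_pderiv_mul_add (hF : IsCc k F) (hk : k ≠ 0) (hΨ : IsCc l Ψ) (hl : l ≠ 0)
    (s : ℝ) {x : ι} (h0 : ∀ φ, φ x = 0 → Ψ φ = 0) :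
    ∫ φ in posSet x, (pderiv x F φ * Ψ φ + F φ * pderiv x Ψ φ) ∂(piRef ι s) = 0 := by
  have hF₁ := hF.continuous_pderiv hk x
  have hΨ₁ := hΨ.continuous_pderiv hl x
  exact setIntegral_posSet_eq_zero_of_hasDerivAt s x (G := fun φ => F φ * Ψ φ)
    (hF.continuous.mul hΨ.continuous)
    ((hF₁.mul hΨ.continuous).add (hF.continuous.mul hΨ₁)) hF.compactSupport.mul_right
    (hΨ.compactSupport.mul_left.add hF.compactSupport.mul_right)
    (fun φ h => by rw [h0 φ h, mul_zero])
    fun φ t ht => (hF.hasDerivAt hk x φ ht).mul (hΨ.hasDerivAt hl x φ ht)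

end Reference

/-! ### The gradient operator -/

theorem continuous_integral_Lp_mul {α : Type*} [MeasurableSpace α] {m : Measure α} {f : α → ℝ}
    (hf : MemLp f 2 m) : Continuous fun g : Lp ℝ 2 m => ∫ a, g a * f a ∂m := by
  have heq (g : Lp ℝ 2 m) : ∫ a, g a * f a ∂m = inner ℝ hf.toLp g := by
    rw [L2.inner_def]
    refine integral_congr_ae (hf.coeFn_toLp.mono fun a ha => ?_)
    simp only [ha]
    rfl
  simp only [heq]
  fun_prop

theorem continuous_setIntegral_Lp_mul {α : Type*} [MeasurableSpace α] {m : Measure α} {f : α → ℝ}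
    (hf : MemLp f 2 m) {A : Set α} (hA : MeasurableSet A) :
    Continuous fun g : Lp ℝ 2 m => ∫ a in A, g a * f a ∂m := by
  refine (continuous_integral_Lp_mul (hf.indicator hA)).congr fun g => ?_
  simp only [← integral_indicator hA, ← indicator_mul_right]

section Gradient

variable {ι : Type*} [Fintype ι] {s : ℝ} {ρ : (ι → ℝ≥0) → ℝ} {μ : Measure (ι → ℝ≥0)}

/-- `μ` has the continuous, strictly positive density `ρ` with respect to the reference measure. -/
structure HasPosDensity (s : ℝ) (ρ : (ι → ℝ≥0) → ℝ) (μ : Measure (ι → ℝ≥0)) : Prop where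
  continuous : Continuous ρ
  pos : ∀ φ, 0 < ρ φ
  eq_withDensity : μ = (piRef ι s).withDensity fun φ => ENNReal.ofReal (ρ φ)

namespace HasPosDensity

theorem absolutelyContinuous (h : HasPosDensity s ρ μ) : piRef ι s ≪ μ := by
  rw [h.eq_withDensity]
  exact withDensity_absolutelyContinuous' h.continuous.measurable.ennreal_ofReal.aemeasurable
    (.of_forall fun φ => (ENNReal.ofReal_pos.2 (h.pos φ)).ne')

theorem absolutelyContinuous_piRef (h : HasPosDensity s ρ μ) : μ ≪ piRef ι s :=
  h.eq_withDensity ▸ withDensity_absolutelyContinuous _ _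

theorem isOpenPosMeasure (h : HasPosDensity s ρ μ) : μ.IsOpenPosMeasure :=
  h.absolutelyContinuous.isOpenPosMeasure

theorem setIntegral_mul_div (h : HasPosDensity s ρ μ) {A : Set (ι → ℝ≥0)} (hA : MeasurableSet A)
    (f g : (ι → ℝ≥0) → ℝ) : ∫ φ in A, f φ * (g φ / ρ φ) ∂μ = ∫ φ in A, f φ * g φ ∂(piRef ι s) := by
  rw [h.eq_withDensity, setIntegral_withDensity_eq_setIntegral_toReal_smul
    h.continuous.measurable.ennreal_ofReal (.of_forall fun _ => ENNReal.ofReal_lt_top) _ hA]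
  refine integral_congr_ae (.of_forall fun φ => ?_)
  have := (h.pos φ).ne'
  simp only [ENNReal.toReal_ofReal (h.pos φ).le, smul_eq_mul]
  field_simp

theorem memLp_div [IsFiniteMeasureOnCompacts μ] (h : HasPosDensity s ρ μ) {f : (ι → ℝ≥0) → ℝ}
    (hf : Continuous f) (hc : HasCompactSupport f) : MemLp (fun φ => f φ / ρ φ) 2 μ := by
  simp only [div_eq_mul_inv]
  exact (hf.mul (h.continuous.inv₀ fun φ => (h.pos φ).ne')).memLp_of_hasCompactSupport hc.mul_right

theorem locallyIntegrable (h : HasPosDensity s ρ μ) {A : Set (ι → ℝ≥0)} (hA : MeasurableSet A)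
    {g : (ι → ℝ≥0) → ℝ} (hg : IntegrableOn g A μ) :
    LocallyIntegrable g ((piRef ι s).restrict A) := by
  rw [IntegrableOn, h.eq_withDensity, restrict_withDensity hA,
    integrable_withDensity_iff_integrable_smul' h.continuous.measurable.ennreal_ofReal
      (.of_forall fun _ => ENNReal.ofReal_lt_top)] at hg
  have hdiv := (hg.locallyIntegrable.locallyIntegrableOn univ).continuousOn_mul
    (h.continuous.inv₀ fun φ => (h.pos φ).ne').continuousOn isOpen_univ.isLocallyClosed
  rw [locallyIntegrableOn_univ] at hdiv
  refine hdiv.congr (.of_forall fun φ => ?_)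
  have := (h.pos φ).ne'
  simp only [Pi.inv_apply, ENNReal.toReal_ofReal (h.pos φ).le, smul_eq_mul]
  field_simp

end HasPosDensity

variable [DecidableEq ι]

/-- `g` is a weak partial derivative `∂_x u` on `{φ_x > 0}`, tested against the functions of class
`C_c^2` that vanish on the face `{φ_x = 0}`. -/
def HasWeakPDeriv (s : ℝ) (x : ι) (u g : (ι → ℝ≥0) → ℝ) : Prop :=
  ∀ Ψ : (ι → ℝ≥0) → ℝ, IsCc 2 Ψ → (∀ φ, φ x = 0 → Ψ φ = 0) →
    ∫ φ in posSet x, g φ * Ψ φ ∂(piRef ι s) + ∫ φ in posSet x, u φ * pderiv x Ψ φ ∂(piRef ι s) = 0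

namespace HasWeakPDeriv

variable {x : ι} {u u' g g' : (ι → ℝ≥0) → ℝ}

theorem congr (h : HasWeakPDeriv s x u g) (hu : u =ᵐ[(piRef ι s).restrict (posSet x)] u')
    (hg : g =ᵐ[(piRef ι s).restrict (posSet x)] g') : HasWeakPDeriv s x u' g' := by
  intro Ψ hΨ h0
  rw [← h Ψ hΨ h0]
  congr 1
  exacts [integral_congr_ae (hg.symm.mul .rfl), integral_congr_ae (hu.symm.mul .rfl)]

theorem integral_mul_eq_zero_of_const (h : HasWeakPDeriv s x u g) {U : Set (ι → ℝ≥0)} {c : ℝ}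
    (hc : ∀ᵐ φ ∂(piRef ι s).restrict (posSet x), φ ∈ U → u φ = c) {Ψ : (ι → ℝ≥0) → ℝ}
    (hΨ : IsCc 2 Ψ) (h0 : ∀ φ, φ x = 0 → Ψ φ = 0) (hΨU : tsupport Ψ ⊆ U) :
    ∫ φ in posSet x, g φ * Ψ φ ∂(piRef ι s) = 0 := by
  have hconst : ∫ φ in posSet x, u φ * pderiv x Ψ φ ∂(piRef ι s) =
      ∫ φ in posSet x, c * pderiv x Ψ φ ∂(piRef ι s) := by
    refine integral_congr_ae (hc.mono fun φ hφ => ?_)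
    by_cases hφU : φ ∈ U
    · simp only [hφ hφU]
    · have : pderiv x Ψ φ = 0 := image_eq_zero_of_notMem_tsupport fun hmem =>
        hφU (hΨU (hΨ.tsupport_pderiv_subset two_ne_zero x hmem))
      simp only [this, mul_zero]
  simpa only [hconst, integral_const_mul, hΨ.setIntegral_pderiv_eq_zero two_ne_zero s h0,
    mul_zero, add_zero] using h Ψ hΨ h0

theorem ae_eq_zero_of_const (h : HasWeakPDeriv s x u g) {U : Set (ι → ℝ≥0)} (hU : IsOpen U) {c : ℝ}
    (hg : LocallyIntegrable g ((piRef ι s).restrict (posSet x)))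
    (hc : ∀ᵐ φ ∂(piRef ι s).restrict (posSet x), φ ∈ U → u φ = c) :
    ∀ᵐ φ ∂(piRef ι s).restrict (posSet x), φ ∈ U → g φ = 0 := by
  have hemb := isClosedEmbedding_emb (ι := ι).measurableEmbedding
  let W : Set (ι → ℝ) := retr ⁻¹' U ∩ {w | 0 < w x}
  have hW : IsOpen W :=
    (hU.preimage continuous_retr).inter (isOpen_lt continuous_const (continuous_apply x))
  have hloc : LocallyIntegrable (g ∘ retr) (((piRef ι s).restrict (posSet x)).map emb) := by
    intro w
    obtain ⟨O, hO, hgO⟩ := hg (retr w)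
    refine ⟨retr ⁻¹' O, continuous_retr.continuousAt hO, ?_⟩
    rwa [hemb.integrableOn_map_iff, ← preimage_comp, Function.comp_assoc,
      show retr ∘ (emb : (ι → ℝ≥0) → ι → ℝ) = id from funext retr_emb]
  have hW0 := hW.ae_eq_zero_of_integral_contDiff_smul_eq_zero (hloc.locallyIntegrableOn W)
    fun ψ hψ hψc hψW => ?_
  · rw [hemb.ae_map_iff] at hW0
    filter_upwards [hW0, ae_restrict_mem (measurableSet_posSet x)] with φ hφ hφx hφU
    simpa [retr_emb] using hφ ⟨by rwa [mem_preimage, retr_emb], NNReal.coe_pos.2 hφx⟩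
  · have hψU : tsupport (fun φ => ψ (emb φ)) ⊆ U := fun φ hφ => by
      have := (hψW (tsupport_comp_subset_preimage ψ continuous_emb hφ)).1
      rwa [mem_preimage, retr_emb] at this
    have hψ0 (φ : ι → ℝ≥0) (hφ : φ x = 0) : ψ (emb φ) = 0 :=
      image_eq_zero_of_notMem_tsupport fun hmem => by simpa [emb, hφ] using (hψW hmem).2
    have hint := h.integral_mul_eq_zero_of_const hc (.comp_emb (contDiff_infty.1 hψ 2) hψc) hψ0 hψU
    simpa only [hemb.integral_map, Function.comp_apply, retr_emb, smul_eq_mul, mul_comm] using hint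

end HasWeakPDeriv

variable {k : ℕ} {F : (ι → ℝ≥0) → ℝ}

theorem IsCc.hasWeakPDeriv (hF : IsCc k F) (hk : k ≠ 0) (s : ℝ) (x : ι) :
    HasWeakPDeriv s x F (pderiv x F) := by
  intro Ψ hΨ h0
  rw [← integral_add, hF.setIntegral_pderiv_mul_add hk hΨ two_ne_zero s h0]
  · exact (((hF.continuous_pderiv hk x).mul hΨ.continuous).integrable_of_hasCompactSupport
      hΨ.compactSupport.mul_left).integrableOn
  · exact ((hF.continuous.mul (hΨ.continuous_pderiv two_ne_zero x)).integrable_of_hasCompactSupport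
      hF.compactSupport.mul_right).integrableOn

theorem IsCc.memLp (hF : IsCc k F) (m : Measure (ι → ℝ≥0)) [IsFiniteMeasureOnCompacts m] :
    MemLp F 2 m :=
  hF.continuous.memLp_of_hasCompactSupport hF.compactSupport

theorem IsCc.memLp_pderiv (hF : IsCc k F) (hk : k ≠ 0) (x : ι) (m : Measure (ι → ℝ≥0))
    [IsFiniteMeasureOnCompacts m] : MemLp (pderiv x F) 2 m :=
  (hF.continuous_pderiv hk x).memLp_of_hasCompactSupport (hF.hasCompactSupport_pderiv hk x)

/-- The space of square integrable gradient fields; the component at `x` lives on `{φ_x > 0}`. -/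
abbrev GradSpace (μ : Measure (ι → ℝ≥0)) : Type _ :=
  PiLp 2 fun x : ι => Lp ℝ 2 (μ.restrict (posSet x))

/-- The graph of the gradient on `C_c^2`, as a subspace of `L²(μ) × GradSpace μ`. -/
def gradGraph (μ : Measure (ι → ℝ≥0)) : Submodule ℝ (Lp ℝ 2 μ × GradSpace μ) where
  carrier := {z | ∃ F : (ι → ℝ≥0) → ℝ, IsCc 2 F ∧ z.1 =ᵐ[μ] F ∧
    ∀ x, z.2 x =ᵐ[μ.restrict (posSet x)] pderiv x F}
  add_mem' := by
    rintro a b ⟨F, hF, haF, haF'⟩ ⟨G, hG, hbG, hbG'⟩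
    refine ⟨F + G, hF.add hG, (Lp.coeFn_add _ _).trans (haF.add hbG), fun x => ?_⟩
    rw [hF.pderiv_add hG two_ne_zero]
    exact (Lp.coeFn_add _ _).trans ((haF' x).add (hbG' x))
  zero_mem' := by
    refine ⟨0, IsCc.zero, Lp.coeFn_zero _ _ _, fun x => ?_⟩
    have hzero : pderiv x (0 : (ι → ℝ≥0) → ℝ) = 0 := by
      simpa only [zero_smul] using (IsCc.zero (ι := ι)).pderiv_const_smul two_ne_zero 0 x
    rw [hzero]
    exact Lp.coeFn_zero _ _ _
  smul_mem' := by
    rintro c a ⟨F, hF, haF, haF'⟩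
    refine ⟨c • F, hF.const_smul c, (Lp.coeFn_smul _ _).trans (haF.const_smul c), fun x => ?_⟩
    rw [hF.pderiv_const_smul two_ne_zero]
    exact (Lp.coeFn_smul _ _).trans ((haF' x).const_smul c)

theorem IsCc.exists_mem_gradGraph [IsFiniteMeasureOnCompacts μ] (hF : IsCc 2 F) :
    ∃ z ∈ gradGraph μ, z.1 =ᵐ[μ] F ∧ ∀ x, z.2 x =ᵐ[μ.restrict (posSet x)] pderiv x F := by
  let z : Lp ℝ 2 μ × GradSpace μ := ((hF.memLp μ).toLp,
    WithLp.toLp 2 fun x => (hF.memLp_pderiv two_ne_zero x (μ.restrict (posSet x))).toLp)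
  have hz : z.1 =ᵐ[μ] F ∧ ∀ x, z.2 x =ᵐ[μ.restrict (posSet x)] pderiv x F :=
    ⟨(hF.memLp μ).coeFn_toLp, fun x => (hF.memLp_pderiv two_ne_zero x _).coeFn_toLp⟩
  exact ⟨z, ⟨F, hF, hz⟩, hz⟩

namespace HasPosDensity

variable {z : Lp ℝ 2 μ × GradSpace μ}

theorem hasWeakPDeriv_of_mem_closure [IsFiniteMeasureOnCompacts μ] (h : HasPosDensity s ρ μ)
    (hz : z ∈ (gradGraph μ).topologicalClosure) (x : ι) : HasWeakPDeriv s x z.1 (z.2 x) := by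
  intro Ψ hΨ h0
  have hΨ₁ : MemLp (fun φ => Ψ φ / ρ φ) 2 (μ.restrict (posSet x)) :=
    (h.memLp_div hΨ.continuous hΨ.compactSupport).restrict _
  have hΨ₂ : MemLp (fun φ => pderiv x Ψ φ / ρ φ) 2 μ :=
    h.memLp_div (hΨ.continuous_pderiv two_ne_zero x) (hΨ.hasCompactSupport_pderiv two_ne_zero x)
  have hclosed : IsClosed {w : Lp ℝ 2 μ × GradSpace μ |
      ∫ φ in posSet x, w.2 x φ * (Ψ φ / ρ φ) ∂μ +
        ∫ φ in posSet x, w.1 φ * (pderiv x Ψ φ / ρ φ) ∂μ = 0} :=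
    isClosed_eq (((continuous_integral_Lp_mul hΨ₁).comp
        ((PiLp.continuous_apply 2 _ x).comp continuous_snd)).add
      ((continuous_setIntegral_Lp_mul hΨ₂ (measurableSet_posSet x)).comp continuous_fst))
      continuous_const
  simp only [h.setIntegral_mul_div (measurableSet_posSet x)] at hclosed
  refine closure_minimal ?_ hclosed hz
  rintro w ⟨F, hF, hwF, hwF'⟩
  have hac := h.absolutelyContinuous.restrict (posSet x)
  exact (hF.hasWeakPDeriv two_ne_zero s x).congr (hac.ae_eq (ae_restrict_of_ae hwF.symm))
    (hac.ae_eq (hwF' x).symm) Ψ hΨ h0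

variable [IsFiniteMeasure μ]

theorem snd_ae_eq_zero_of_fst_ae_eq_const (h : HasPosDensity s ρ μ)
    (hz : z ∈ (gradGraph μ).topologicalClosure) {U : Set (ι → ℝ≥0)} (hU : IsOpen U) {c : ℝ}
    (hc : ∀ᵐ φ ∂μ, φ ∈ U → z.1 φ = c) (x : ι) :
    ∀ᵐ φ ∂μ.restrict (posSet x), φ ∈ U → z.2 x φ = 0 := by
  have hint : IntegrableOn (z.2 x) (posSet x) μ := (Lp.memLp (z.2 x)).integrable one_le_two
  exact (h.absolutelyContinuous_piRef.restrict _).ae_le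
    ((h.hasWeakPDeriv_of_mem_closure hz x).ae_eq_zero_of_const hU
      (h.locallyIntegrable (measurableSet_posSet x) hint)
      (ae_restrict_of_ae (h.absolutelyContinuous.ae_le hc)))

theorem snd_eq_zero_of_fst_eq_zero (h : HasPosDensity s ρ μ)
    (hz : z ∈ (gradGraph μ).topologicalClosure) (hz0 : z.1 = 0) : z.2 = 0 := by
  have hfst : ∀ᵐ φ ∂μ, φ ∈ (univ : Set (ι → ℝ≥0)) → z.1 φ = 0 := by
    rw [hz0]
    exact (Lp.coeFn_zero ℝ 2 μ).mono fun φ hφ _ => hφ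
  ext1 x
  refine Lp.ext (.trans ?_ (Lp.coeFn_zero ℝ 2 _).symm)
  exact (h.snd_ae_eq_zero_of_fst_ae_eq_const hz isOpen_univ hfst x).mono fun φ hφ => hφ trivial

end HasPosDensity

/-- The gradient `u ↦ (∂_x u)_x` on `C_c^2`, as an unbounded operator from `L²(μ)`. -/
def gradOp (μ : Measure (ι → ℝ≥0)) : Lp ℝ 2 μ →ₗ.[ℝ] GradSpace μ := (gradGraph μ).toLinearPMap

theorem HasPosDensity.graph_gradOp [IsFiniteMeasure μ] (h : HasPosDensity s ρ μ) :
    (gradOp μ).graph = gradGraph μ :=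
  Submodule.toLinearPMap_graph_eq _ fun _ hz =>
    h.snd_eq_zero_of_fst_eq_zero (Submodule.le_topologicalClosure _ hz)

theorem HasPosDensity.isClosable_gradOp [IsFiniteMeasure μ] (h : HasPosDensity s ρ μ) :
    (gradOp μ).IsClosable :=
  ⟨(gradGraph μ).topologicalClosure.toLinearPMap, by
    rw [h.graph_gradOp, Submodule.toLinearPMap_graph_eq _ fun _ => h.snd_eq_zero_of_fst_eq_zero]⟩

theorem HasPosDensity.graph_closure_gradOp [IsFiniteMeasure μ] (h : HasPosDensity s ρ μ) :
    (gradOp μ).closure.graph = (gradGraph μ).topologicalClosure := by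
  rw [← h.isClosable_gradOp.graph_closure_eq_closure_graph, h.graph_gradOp]

end Gradient

/-! ### Approximation by functions of class `C_c^2` -/

section Approximation

open scoped Convolution ContDiff

theorem lipschitzWith_normed_convolution {E F : Type*} [NormedAddCommGroup E] [NormedSpace ℝ E]
    [FiniteDimensional ℝ E] [MeasurableSpace E] [BorelSpace E] [NormedAddCommGroup F]
    [NormedSpace ℝ F] (χ : ContDiffBump (0 : E)) (m : Measure E)
    [m.IsAddHaarMeasure] {K : ℝ≥0} {f : E → F} (hf : LipschitzWith K f) :
    LipschitzWith K (χ.normed m ⋆[ContinuousLinearMap.lsmul ℝ ℝ, m] f) := by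
  have hint (x : E) : Integrable (fun t => χ.normed m t • f (x - t)) m :=
    (χ.contDiff_normed.continuous (n := 0).smul
      (hf.continuous.comp (continuous_const.sub continuous_id))).integrable_of_hasCompactSupport
      χ.hasCompactSupport_normed.smul_right
  refine .of_dist_le_mul fun x y => ?_
  have hle (t : E) : ‖χ.normed m t • f (x - t) - χ.normed m t • f (y - t)‖ ≤
      χ.normed m t * (K * dist x y) := by
    rw [← smul_sub, norm_smul, Real.norm_of_nonneg (χ.nonneg_normed t), ← dist_eq_norm]
    gcongr
    · exact χ.nonneg_normed t
    · simpa only [dist_sub_right] using hf.dist_le_mul (x - t) (y - t)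
  rw [dist_eq_norm, convolution_lsmul, convolution_lsmul, ← integral_sub (hint x) (hint y)]
  refine (norm_integral_le_of_norm_le (χ.integrable_normed.mul_const _) (.of_forall hle)).trans ?_
  rw [integral_mul_const, χ.integral_normed, one_mul]

theorem exists_contDiff_lipschitzWith_dist_le {E F : Type*} [NormedAddCommGroup E]
    [NormedSpace ℝ E] [FiniteDimensional ℝ E] [NormedAddCommGroup F] [NormedSpace ℝ F]
    [CompleteSpace F] {K : ℝ≥0} {f : E → F} (hf : LipschitzWith K f) {ε : ℝ} (hε : 0 < ε) :
    ∃ g : E → F, ContDiff ℝ ∞ g ∧ LipschitzWith K g ∧ ∀ x, dist (g x) (f x) ≤ ε := by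
  borelize E
  let m : Measure E := .addHaar
  have hr : 0 < ε / (K + 1) := by positivity
  let χ : ContDiffBump (0 : E) := ⟨ε / (K + 1) / 2, ε / (K + 1), half_pos hr, half_lt_self hr⟩
  refine ⟨χ.normed m ⋆[ContinuousLinearMap.lsmul ℝ ℝ, m] f,
    χ.hasCompactSupport_normed.contDiff_convolution_left _ χ.contDiff_normed
      hf.continuous.locallyIntegrable,
    lipschitzWith_normed_convolution χ m hf,
    fun x => χ.dist_normed_convolution_le hf.continuous.aestronglyMeasurable fun y hy => ?_⟩
  calc dist (f y) (f x) ≤ K * dist y x := hf.dist_le_mul y x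
    _ ≤ (K + 1) * (ε / (K + 1)) := by
        gcongr
        · linarith
        · exact (Metric.mem_ball.1 hy).le
    _ = ε := by field_simp

variable {ι : Type*} [Fintype ι] [DecidableEq ι]

theorem exists_isCc_forall_abs_sub_lt {f : (ι → ℝ≥0) → ℝ} (hf : Continuous f)
    (hc : HasCompactSupport f) {ε : ℝ} (hε : 0 < ε) :
    ∃ F : (ι → ℝ≥0) → ℝ, IsCc 2 F ∧ ∀ φ, |f φ - F φ| < ε := by
  -- Extending `f` by even reflection keeps the support compact, unlike `f ∘ retr`.
  let h : (ι → ℝ) → ℝ := fun u => f fun x => ‖u x‖₊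
  have hh : Continuous h := by fun_prop
  obtain ⟨R, hR⟩ := (hc.isCompact.image continuous_emb).isBounded.subset_closedBall 0
  have hsupp : Function.support h ⊆ Metric.closedBall 0 R := by
    intro u hu
    have hmem := hR ⟨_, subset_tsupport f hu, rfl⟩
    have hnorm : ‖emb fun x => ‖u x‖₊‖ = ‖u‖ := by
      simp [Pi.norm_def, emb, nnnorm]
    rwa [mem_closedBall_zero_iff, hnorm, ← mem_closedBall_zero_iff] at hmem
  obtain ⟨g, hg, hgf, hgh⟩ := hh.exists_contDiff_approx 2 (ε := fun _ => ε) continuous_const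
    fun _ => hε
  refine ⟨fun φ => g (emb φ), .comp_emb hg
    (.of_support_subset_isCompact (isCompact_closedBall 0 R) (hgh.trans hsupp)), fun φ => ?_⟩
  have hhf : h (emb φ) = f φ := congrArg f (funext fun x => by simp [emb])
  simpa only [Real.dist_eq, abs_sub_comm, hhf] using hgf (emb φ)

theorem exists_isCc_eLpNorm_sub_le {m : Measure (ι → ℝ≥0)} [IsFiniteMeasure m] {p : ℝ≥0∞}
    (hp : p ≠ ⊤) (hp₁ : 1 ≤ p) {u : (ι → ℝ≥0) → ℝ} (hu : MemLp u p m) {ε : ℝ} (hε : 0 < ε) :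
    ∃ F : (ι → ℝ≥0) → ℝ, IsCc 2 F ∧ eLpNorm (u - F) p m ≤ ENNReal.ofReal ε := by
  have hemb := isClosedEmbedding_emb (ι := ι).measurableEmbedding
  have hretr (f : (ι → ℝ≥0) → ℝ) : (f ∘ retr) ∘ emb = f := funext fun φ => congrArg f (retr_emb φ)
  have hu' : MemLp (u ∘ retr) p (m.map emb) := by rwa [hemb.memLp_map_measure_iff, hretr]
  obtain ⟨g, hgc, hg, hug⟩ := hu'.exist_eLpNorm_sub_le hp hp₁ hε
  refine ⟨fun φ => g (emb φ), .comp_emb (contDiff_infty.1 hg 2) hgc, ?_⟩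
  rw [hemb.eLpNorm_map_measure] at hug
  convert hug using 2
  funext φ
  simp [retr_emb]

end Approximation

/-! ### Cutoff functions -/

section Cutoff

theorem tendsto_Lp_of_ae_bound {α : Type*} [MeasurableSpace α] {m : Measure α} [IsFiniteMeasure m]
    {z : ℕ → Lp ℝ 2 m} {u : Lp ℝ 2 m} {C : ℝ} (hC : ∀ n, ∀ᵐ a ∂m, |z n a - u a| ≤ C)
    (hlim : ∀ᵐ a ∂m, Tendsto (fun n => z n a) atTop (𝓝 (u a))) : Tendsto z atTop (𝓝 u) := by
  have hnorm (n : ℕ) : ‖z n - u‖ ^ 2 = ∫ a, (z n a - u a) ^ 2 ∂m := by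
    rw [← real_inner_self_eq_norm_sq, L2.inner_def]
    refine integral_congr_ae ((Lp.coeFn_sub (z n) u).mono fun a ha => ?_)
    simp only [ha, Pi.sub_apply, real_inner_self_eq_norm_sq, Real.norm_eq_abs, sq_abs]
  have hsq : Tendsto (fun n => ‖z n - u‖ ^ 2) atTop (𝓝 0) := by
    simp only [hnorm]
    rw [← integral_zero α ℝ (μ := m)]
    refine tendsto_integral_of_dominated_convergence (fun _ => C ^ 2) (fun n => ?_)
      (integrable_const _) (fun n => ?_) ?_
    · exact (((Lp.aestronglyMeasurable _).sub (Lp.aestronglyMeasurable _)).pow 2)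
    · filter_upwards [hC n] with a ha
      rw [norm_pow, Real.norm_eq_abs]
      gcongr
    · filter_upwards [hlim] with a ha
      simpa using (ha.sub_const (u a)).pow 2
  rw [tendsto_iff_norm_sub_tendsto_zero]
  simpa using hsq.sqrt

variable {ι : Type*} [Fintype ι] [DecidableEq ι]

theorem pderiv_comp_smul_emb {f : (ι → ℝ) → ℝ} (hf : ContDiff ℝ 1 f) (a : ℝ) (x : ι)
    (φ : ι → ℝ≥0) :
    pderiv x (fun φ => f (a • emb φ)) φ = a * fderiv ℝ f (a • emb φ) (Pi.single x 1) := by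
  rw [pderiv_comp_emb (f := fun u => f (a • u)) (hf.comp (contDiff_const_smul a))]
  simp only [fderiv_comp_smul, smul_apply, smul_eq_mul]

variable (ι) in
theorem exists_isCc_cutoff : ∃ (F : ℕ → (ι → ℝ≥0) → ℝ) (C : ℝ), (∀ n, IsCc 2 (F n)) ∧
    (∀ n φ, F n φ ∈ Icc 0 1) ∧ (∀ φ, Tendsto (fun n => F n φ) atTop (𝓝 1)) ∧
    ∀ n x φ, |pderiv x (F n) φ| ≤ 1 / ((n : ℝ) + 1) * C := by
  let χ : ContDiffBump (0 : ι → ℝ) := ⟨1, 2, one_pos, one_lt_two⟩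
  let a : ℕ → ℝ := fun n => 1 / ((n : ℝ) + 1)
  have ha (n : ℕ) : 0 < a n := by positivity
  obtain ⟨C, hC⟩ := (χ.hasCompactSupport.fderiv ℝ).exists_bound_of_continuous
    (χ.contDiff.continuous_fderiv (n := 1) one_ne_zero)
  refine ⟨fun n φ => χ (a n • emb φ), C, fun n => ?_, fun n φ => ⟨χ.nonneg, χ.le_one⟩,
    fun φ => ?_, fun n x φ => ?_⟩
  · exact .comp_emb (f := fun u => χ (a n • u)) (χ.contDiff.comp (contDiff_const_smul (a n)))
      (χ.hasCompactSupport.comp_homeomorph (.smulOfNeZero (a n) (ha n).ne'))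
  · have hlim : Tendsto (fun n => a n • emb φ) atTop (𝓝 0) := by
      simpa [a] using (tendsto_one_div_add_atTop_nhds_zero_nat (𝕜 := ℝ)).smul_const (emb φ)
    simpa only [Function.comp_def, χ.one_of_mem_closedBall (Metric.mem_closedBall_self zero_le_one)]
      using (χ.continuous.tendsto 0).comp hlim
  · rw [pderiv_comp_smul_emb χ.contDiff, abs_mul, abs_of_pos (ha n)]
    gcongr
    simpa only [Real.norm_eq_abs, Pi.norm_single, abs_one, mul_one] using
      (fderiv ℝ χ (a n • emb φ)).le_of_opNorm_le (hC _) (Pi.single x 1)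

theorem const_one_mem_closure_gradGraph (μ : Measure (ι → ℝ≥0)) [IsFiniteMeasure μ] :
    (Lp.const 2 μ (1 : ℝ), (0 : GradSpace μ)) ∈ (gradGraph μ).topologicalClosure := by
  obtain ⟨F, C, hF, hF01, hlim, hgrad⟩ := exists_isCc_cutoff ι
  choose z hz hzF hzF' using fun n => (hF n).exists_mem_gradGraph (μ := μ)
  have hfst : Tendsto (fun n => (z n).1) atTop (𝓝 (Lp.const 2 μ (1 : ℝ))) := by
    refine tendsto_Lp_of_ae_bound (C := 1) (fun n => ?_) ?_
    · filter_upwards [hzF n, Lp.coeFn_const (p := 2) (μ := μ) (1 : ℝ)] with φ hφ h1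
      rw [hφ, h1, Function.const_apply, abs_le]
      constructor <;> linarith [(hF01 n φ).1, (hF01 n φ).2]
    · filter_upwards [ae_all_iff.2 hzF, Lp.coeFn_const (p := 2) (μ := μ) (1 : ℝ)] with φ hφ h1
      simpa only [hφ, h1, Function.const_apply] using hlim φ
  have hsnd (x : ι) : Tendsto (fun n => (z n).2 x) atTop (𝓝 0) := by
    have ha := (tendsto_one_div_add_atTop_nhds_zero_nat (𝕜 := ℝ)).mul_const C
    rw [zero_mul] at ha
    have hC (n : ℕ) : 0 ≤ 1 / ((n : ℝ) + 1) * C := (abs_nonneg _).trans (hgrad n x 0)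
    refine squeeze_zero_norm (fun n => Lp.norm_le_of_ae_bound (hC n)
      ((hzF' n x).mono fun φ hφ => ?_)) (by simpa using ha.const_mul _)
    rw [hφ]
    exact hgrad n x φ
  refine mem_closure_of_tendsto (hfst.prodMk_nhds ?_) (.of_forall hz)
  exact ((PiLp.continuous_toLp 2 _).tendsto 0).comp (tendsto_pi_nhds.2 hsnd)

end Cutoff

/-! ### The Dirichlet form of a measure with positive density -/

section Contraction

theorem exists_contDiff_lipschitzWith_abs_sub_le {K : ℝ≥0} {κ : ℝ → ℝ} (hκ : LipschitzWith K κ)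
    (h0 : κ 0 = 0) {ε : ℝ} (hε : 0 < ε) : ∃ j : ℝ → ℝ, ContDiff ℝ 2 j ∧ LipschitzWith K j ∧
      j 0 = 0 ∧ ∀ t, |j t - κ t| ≤ ε := by
  obtain ⟨g, hg, hgK, hgκ⟩ := exists_contDiff_lipschitzWith_dist_le hκ (half_pos hε)
  have hg0 : |g 0| ≤ ε / 2 := by simpa [h0] using hgκ 0
  refine ⟨fun t => g t - g 0, (contDiff_infty.1 hg 2).sub contDiff_const, ?_, sub_self _,
    fun t => ?_⟩
  · exact .of_dist_le_mul fun a b => by simpa only [dist_sub_right] using hgK.dist_le_mul a b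
  · calc |g t - g 0 - κ t| = |(g t - κ t) - g 0| := by ring_nf
      _ ≤ |g t - κ t| + |g 0| := abs_sub _ _
      _ ≤ ε / 2 + ε / 2 := add_le_add (hgκ t) hg0
      _ = ε := add_halves ε

variable {ι : Type*} [Fintype ι] [DecidableEq ι] {μ : Measure (ι → ℝ≥0)} {K : ℝ≥0}

theorem norm_le_mul_norm_of_ae_eq_pderiv_comp {F : (ι → ℝ≥0) → ℝ} (hF : IsCc 2 F) {j : ℝ → ℝ}
    (hj : ContDiff ℝ 1 j) (hjK : LipschitzWith K j) {g g' : GradSpace μ}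
    (hg : ∀ x, g x =ᵐ[μ.restrict (posSet x)] pderiv x F)
    (hg' : ∀ x, g' x =ᵐ[μ.restrict (posSet x)] pderiv x (j ∘ F)) : ‖g'‖ ≤ K * ‖g‖ := by
  refine le_of_sq_le_sq ?_ (by positivity)
  rw [mul_pow, PiLp.norm_sq_eq_of_L2, PiLp.norm_sq_eq_of_L2, Finset.mul_sum]
  refine Finset.sum_le_sum fun x _ => ?_
  rw [← mul_pow]
  gcongr
  refine Lp.norm_le_mul_norm_of_ae_le_mul ?_
  filter_upwards [hg x, hg' x] with φ hφ hφ'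
  rw [hφ, hφ', hF.pderiv_comp two_ne_zero hj, norm_mul]
  gcongr
  exact norm_deriv_le_of_lipschitz hjK

variable [IsFiniteMeasure μ] {z : Lp ℝ 2 μ × GradSpace μ} {κ : ℝ → ℝ}

theorem exists_mem_closure_gradGraph_compLp_of_mem (hκ : LipschitzWith K κ) (h0 : κ 0 = 0)
    (hz : z ∈ gradGraph μ) :
    ∃ g, (hκ.compLp h0 z.1, g) ∈ (gradGraph μ).topologicalClosure ∧ ‖g‖ ≤ K * ‖z.2‖ := by
  obtain ⟨F, hF, hzF, hzF'⟩ := hz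
  choose j hj hjK hj0 hjκ using fun n : ℕ =>
    exists_contDiff_lipschitzWith_abs_sub_le hκ h0 (Nat.one_div_pos_of_nat (α := ℝ) (n := n))
  choose w hw hwF hwF' using fun n => (hF.comp (hj n) (hj0 n)).exists_mem_gradGraph (μ := μ)
  have hfst : Tendsto (fun n => (w n).1) atTop (𝓝 (hκ.compLp h0 z.1)) := by
    refine tendsto_Lp_of_ae_bound (C := 1) (fun n => ?_) ?_
    · filter_upwards [hwF n, hzF, hκ.coeFn_compLp h0 z.1] with φ hwφ hzφ hκφ
      rw [hwφ, hκφ, Function.comp_apply, Function.comp_apply, hzφ]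
      exact (hjκ n _).trans (div_le_one_of_le₀ (by simp) (by positivity))
    · filter_upwards [ae_all_iff.2 hwF, hzF, hκ.coeFn_compLp h0 z.1] with φ hwφ hzφ hκφ
      simp only [hwφ, hκφ, Function.comp_apply, hzφ]
      rw [tendsto_iff_norm_sub_tendsto_zero]
      exact squeeze_zero (fun _ => norm_nonneg _) (fun n => hjκ n _)
        tendsto_one_div_add_atTop_nhds_zero_nat
  exact exists_mem_norm_le_of_tendsto_fst (gradGraph μ).isClosed_topologicalClosure
    (fun n => (gradGraph μ).le_topologicalClosure (hw n)) hfst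
    (fun n => norm_le_mul_norm_of_ae_eq_pderiv_comp hF ((hj n).of_le one_le_two) (hjK n) hzF'
      (hwF' n)) tendsto_const_nhds

theorem exists_mem_closure_gradGraph_compLp (hκ : LipschitzWith K κ) (h0 : κ 0 = 0)
    (hz : z ∈ (gradGraph μ).topologicalClosure) :
    ∃ g, (hκ.compLp h0 z.1, g) ∈ (gradGraph μ).topologicalClosure ∧ ‖g‖ ≤ K * ‖z.2‖ := by
  obtain ⟨w, hw, hwz⟩ := mem_closure_iff_seq_limit.1 hz
  choose g hg hgw using fun n => exists_mem_closure_gradGraph_compLp_of_mem hκ h0 (hw n)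
  exact exists_mem_norm_le_of_tendsto_fst (gradGraph μ).isClosed_topologicalClosure hg
    (((hκ.continuous_compLp h0).tendsto _).comp ((continuous_fst.tendsto z).comp hwz)) hgw
    (((continuous_snd.tendsto z).comp hwz).norm.const_mul _)

end Contraction

section DirichletForm

open L2Form

variable {ι : Type*} [Fintype ι] [DecidableEq ι] {s : ℝ} {ρ : (ι → ℝ≥0) → ℝ}
  {μ : Measure (ι → ℝ≥0)}

theorem mem_domain_gradOp [IsFiniteMeasureOnCompacts μ] {u : Lp ℝ 2 μ} :
    u ∈ (gradOp μ).domain ↔ ∃ F : (ι → ℝ≥0) → ℝ, IsCc 2 F ∧ u =ᵐ[μ] F := by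
  refine Submodule.mem_map.trans ⟨?_, ?_⟩
  · rintro ⟨z, ⟨F, hF, hzF, -⟩, rfl⟩
    exact ⟨F, hF, hzF⟩
  · rintro ⟨F, hF, hu⟩
    obtain ⟨z, hz, hzF, -⟩ := hF.exists_mem_gradGraph (μ := μ)
    exact ⟨z, hz, Lp.ext (hzF.trans hu.symm)⟩

variable [IsFiniteMeasure μ]

variable (μ) in
theorem ofOperator_gradOp_isDenselyDefined : (ofOperator (gradOp μ)).IsDenselyDefined := by
  intro u
  rw [Metric.mem_closure_iff]
  intro ε hε
  obtain ⟨F, hF, hFu⟩ :=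
    exists_isCc_eLpNorm_sub_le ENNReal.ofNat_ne_top one_le_two (Lp.memLp u) (half_pos hε)
  refine ⟨(hF.memLp μ).toLp, mem_domain_gradOp.2 ⟨F, hF, (hF.memLp μ).coeFn_toLp⟩, ?_⟩
  rw [Lp.dist_def, eLpNorm_congr_ae (.sub .rfl (hF.memLp μ).coeFn_toLp)]
  exact (ENNReal.toReal_le_of_le_ofReal (half_pos hε).le hFu).trans_lt (half_lt_self hε)

namespace HasPosDensity

theorem gradOp_ae_eq (h : HasPosDensity s ρ μ) {F : (ι → ℝ≥0) → ℝ} (hF : IsCc 2 F)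
    {u : (gradOp μ).domain} (hu : (u : Lp ℝ 2 μ) =ᵐ[μ] F) (x : ι) :
    gradOp μ u x =ᵐ[μ.restrict (posSet x)] pderiv x F := by
  obtain ⟨z, hz, hzF, hzF'⟩ := hF.exists_mem_gradGraph (μ := μ)
  have hzu : z.1 = u := Lp.ext (hzF.trans hu.symm)
  rw [← h.graph_gradOp] at hz
  have hsnd : gradOp μ u = z.2 :=
    (LinearPMap.mem_graph_snd_inj _ hz ((gradOp μ).mem_graph u) hzu).symm
  rw [hsnd]
  exact hzF' x

theorem ofOperator_gradOp_form (h : HasPosDensity s ρ μ) {F G : (ι → ℝ≥0) → ℝ} (hF : IsCc 2 F)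
    (hG : IsCc 2 G) {u v : (gradOp μ).domain} (hu : (u : Lp ℝ 2 μ) =ᵐ[μ] F)
    (hv : (v : Lp ℝ 2 μ) =ᵐ[μ] G) : (ofOperator (gradOp μ)).form u v =
      ∑ x, ∫ φ in posSet x, pderiv x F φ * pderiv x G φ ∂μ := by
  rw [ofOperator_form, PiLp.inner_apply]
  refine Finset.sum_congr rfl fun x _ => ?_
  rw [L2.inner_def]
  refine integral_congr_ae ?_
  filter_upwards [h.gradOp_ae_eq hF hu x, h.gradOp_ae_eq hG hv x] with φ hφ hφ'
  rw [hφ, hφ']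
  exact mul_comm _ _

theorem mem_closure_gradGraph (h : HasPosDensity s ρ μ) (u : (gradOp μ).closure.domain) :
    ((u : Lp ℝ 2 μ), (gradOp μ).closure u) ∈ (gradGraph μ).topologicalClosure := by
  rw [← h.graph_closure_gradOp]
  exact (gradOp μ).closure.mem_graph u

theorem exists_closure_gradOp_eq (h : HasPosDensity s ρ μ) {z : Lp ℝ 2 μ × GradSpace μ}
    (hz : z ∈ (gradGraph μ).topologicalClosure) :
    ∃ u : (gradOp μ).closure.domain, (u : Lp ℝ 2 μ) = z.1 ∧ (gradOp μ).closure u = z.2 :=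
  (gradOp μ).closure.mem_graph_iff.1 (h.graph_closure_gradOp ▸ hz)

theorem isClosureOf (h : HasPosDensity s ρ μ) :
    (ofOperator (gradOp μ).closure).IsClosureOf (ofOperator (gradOp μ)) :=
  ofOperator_closure_isClosureOf h.isClosable_gradOp

theorem isMarkovian (h : HasPosDensity s ρ μ) : (ofOperator (gradOp μ).closure).IsMarkovian := by
  intro u v hv
  have hκ : LipschitzWith 1 fun t : ℝ => min (max t 0) 1 :=
    (LipschitzWith.id.max_const 0).min_const 1
  have h0 : min (max (0 : ℝ) 0) 1 = 0 := by simp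
  obtain ⟨g, hg, hgu⟩ := exists_mem_closure_gradGraph_compLp hκ h0 (h.mem_closure_gradGraph u)
  obtain ⟨w, hwv, rfl⟩ := h.exists_closure_gradOp_eq hg
  have hwv' : (w : Lp ℝ 2 μ) = v := hwv.trans (Lp.ext ((hκ.coeFn_compLp h0 _).trans (.symm hv)))
  subst hwv'
  refine ⟨w.2, ?_⟩
  rw [ofOperator_form_self, ofOperator_form_self]
  gcongr
  simpa using hgu

theorem isSymmDirichletForm (h : HasPosDensity s ρ μ) :
    (ofOperator (gradOp μ).closure).IsSymmDirichletForm where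
  denselyDefined := (ofOperator_gradOp_isDenselyDefined μ).mono h.isClosureOf.le
  symm := ofOperator_isSymm
  positive := ofOperator_isPositive
  closed := h.isClosureOf.closed
  markovian := h.isMarkovian

theorem isRegular (h : HasPosDensity s ρ μ) : (ofOperator (gradOp μ).closure).IsRegular where
  fullSupport := h.isOpenPosMeasure
  dense_domain u ε hε := by
    obtain ⟨w, hw⟩ := h.isClosureOf.dense u
    obtain ⟨k, hk⟩ := (hw.eventually (gt_mem_nhds hε)).exists
    obtain ⟨F, hF, hwF⟩ := mem_domain_gradOp.1 (w k).2
    exact ⟨Submodule.inclusion h.isClosureOf.le (w k),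
      ⟨⟨F, hF.continuous⟩, hF.compactSupport⟩, hwF, hk⟩
  dense_continuous f ε hε := by
    obtain ⟨F, hF, hfF⟩ := exists_isCc_forall_abs_sub_lt f.continuous f.hasCompactSupport hε
    have hmem := mem_domain_gradOp.2 ⟨F, hF, (hF.memLp μ).coeFn_toLp⟩
    exact ⟨Submodule.inclusion h.isClosureOf.le ⟨_, hmem⟩,
      ⟨⟨F, hF.continuous⟩, hF.compactSupport⟩, (hF.memLp μ).coeFn_toLp, hfF⟩

theorem snd_ae_eq_zero_of_notMem_supp (h : HasPosDensity s ρ μ) {z : Lp ℝ 2 μ × GradSpace μ}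
    (hz : z ∈ (gradGraph μ).topologicalClosure) (x : ι) :
    ∀ᵐ φ ∂μ.restrict (posSet x), φ ∉ supp z.1 → z.2 x φ = 0 := by
  rw [ae_iff]
  refine measure_null_of_locally_null _ fun φ hφ => ?_
  obtain ⟨hφ, -⟩ : φ ∉ supp z.1 ∧ _ := Classical.not_imp.1 hφ
  simp only [supp, mem_ofPred_eq, not_forall, not_not] at hφ
  obtain ⟨O, hO, hφO, hu⟩ := hφ
  have hnull := h.snd_ae_eq_zero_of_fst_ae_eq_const hz hO hu x
  rw [ae_iff] at hnull
  refine ⟨_, inter_mem_nhdsWithin _ (hO.mem_nhds hφO), measure_mono_null ?_ hnull⟩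
  exact fun ψ hψ => Classical.not_imp.2 ⟨hψ.2, (Classical.not_imp.1 hψ.1).2⟩

theorem isStronglyLocal (h : HasPosDensity s ρ μ) :
    (ofOperator (gradOp μ).closure).IsStronglyLocal := by
  rintro u v - - ⟨U, c, hU, hsub, hc⟩
  rw [ofOperator_form, PiLp.inner_apply]
  refine Finset.sum_eq_zero fun x _ => ?_
  rw [L2.inner_def]
  refine integral_eq_zero_of_ae ?_
  filter_upwards [h.snd_ae_eq_zero_of_fst_ae_eq_const (h.mem_closure_gradGraph v) hU hc x,
    h.snd_ae_eq_zero_of_notMem_supp (h.mem_closure_gradGraph u) x] with φ hv hu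
  by_cases hφ : φ ∈ supp (u : Lp ℝ 2 μ)
  · simp [hv (hsub hφ)]
  · simp [hu hφ]

theorem isConservative (h : HasPosDensity s ρ μ) :
    (ofOperator (gradOp μ).closure).IsConservative := by
  obtain ⟨e, he, hgrad⟩ := h.exists_closure_gradOp_eq (const_one_mem_closure_gradGraph μ)
  have henergy : (ofOperator (gradOp μ).closure).form e e = 0 := by
    rw [ofOperator_form_self, hgrad, norm_zero, zero_pow two_ne_zero]
  refine ⟨e, ?_, henergy, fun T hT t ht => hT.apply_eq_self henergy ht⟩
  rw [he]
  exact Lp.coeFn_const _ _ _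

end HasPosDensity

end DirichletForm

/-! ### Finiteness of the partition function -/

section PartitionFunction

/-- If the factors `T x` are integrated out in decreasing order of `f x`, then each integration
meets a single factor, which is the point of `hdep`. -/
theorem lmarginal_prod_le_prod {ι α : Type*} [DecidableEq ι] [LinearOrder α] {X : ι → Type*}
    [∀ x, MeasurableSpace (X x)] {ν : ∀ x, Measure (X x)} [∀ x, SigmaFinite (ν x)]
    {T : ι → (∀ x, X x) → ℝ≥0∞} (hT : ∀ x, Measurable (T x)) (f : ι → α)
    (hdep : ∀ x y, x ≠ y → f x ≤ f y → ∀ φ t, T x (Function.update φ y t) = T x φ)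
    {K : ι → ℝ≥0∞} (hK : ∀ x φ, ∫⁻ t, T x (Function.update φ x t) ∂(ν x) ≤ K x)
    (S : Finset ι) (φ : ∀ x, X x) :
    (∫⋯∫⁻_S, (fun φ => ∏ x ∈ S, T x φ) ∂ν) φ ≤ ∏ x ∈ S, K x := by
  have hmeas (S : Finset ι) : Measurable fun φ => ∏ x ∈ S, T x φ :=
    Finset.measurable_fun_prod _ fun x _ => hT x
  induction S using Finset.induction_on_max_value f generalizing φ with
  | empty => simp
  | insert a S haS hmax ih =>
    have hinner (φ : ∀ x, X x) : ∫⁻ t, ∏ x ∈ insert a S, T x (Function.update φ a t) ∂(ν a) ≤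
        (∏ x ∈ S, T x φ) * K a := by
      have hfactor (t : X a) : ∏ x ∈ insert a S, T x (Function.update φ a t) =
          (∏ x ∈ S, T x φ) * T a (Function.update φ a t) := by
        rw [Finset.prod_insert haS, mul_comm]
        exact congrArg (· * _) (Finset.prod_congr rfl fun x hx =>
          hdep x a (ne_of_mem_of_not_mem hx haS) (hmax x hx) φ t)
      simp only [hfactor]
      rw [lintegral_const_mul _ (f := fun t => T a (Function.update φ a t))
        ((hT a).comp (measurable_update φ))]
      gcongr
      exact hK a φ
    calc (∫⋯∫⁻_insert a S, (fun φ => ∏ x ∈ insert a S, T x φ) ∂ν) φ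
        ≤ (∫⋯∫⁻_S, (fun φ => (∏ x ∈ S, T x φ) * K a) ∂ν) φ := by
          rw [lmarginal_insert' _ (hmeas _) haS]
          exact lmarginal_mono hinner φ
      _ = (∫⋯∫⁻_S, (fun φ => ∏ x ∈ S, T x φ) ∂ν) φ * K a :=
          lintegral_mul_const _ ((hmeas S).comp measurable_updateFinset)
      _ ≤ ∏ x ∈ insert a S, K x := by
          rw [Finset.prod_insert haS, mul_comm]
          gcongr
          exact ih φ

theorem lintegral_siteMeasure_sub_le (s : ℝ) {g : ℝ → ℝ≥0∞} (hg : ∀ r, g r ≤ 1) (c : ℝ) :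
    ∫⁻ t : ℝ≥0, g (t - c) ∂(siteMeasure s) ≤ ENNReal.ofReal s + ∫⁻ r, g r := by
  rw [siteMeasure, lintegral_add_measure, lintegral_smul_measure, lintegral_dirac, smul_eq_mul]
  refine add_le_add (mul_le_of_le_one_right' (hg _)) ?_
  calc ∫⁻ t : ℝ≥0, g (t - c) ∂halfLineLebesgue = ∫⁻ t in Ici (0 : ℝ), g (t - c) := by
        rw [← map_halfLineLebesgue, measurableEmbedding_nnreal_coe.lintegral_map]
    _ ≤ ∫⁻ t, g (t - c) := setLIntegral_le_lintegral _ _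
    _ = ∫⁻ r, g r := lintegral_sub_right_eq_self g c

/-- The even part of `V`. Every bond occurs in the Hamiltonian in both orientations, so only the
even part of the pair potential matters. -/
def evenPart (V : ℝ → ℝ) (r : ℝ) : ℝ := (V r + V (-r)) / 2

theorem continuous_evenPart {V : ℝ → ℝ} (hV : Continuous V) : Continuous (evenPart V) := by
  unfold evenPart
  fun_prop

theorem le_evenPart {V : ℝ → ℝ} {m : ℝ} (hm : ∀ r, m ≤ V r) (r : ℝ) : m ≤ evenPart V r := by
  rw [evenPart]
  linarith [hm r, hm (-r)]

theorem exp_neg_evenPart_le (V : ℝ → ℝ) (r : ℝ) :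
    Real.exp (-evenPart V r) ≤ (Real.exp (-V r) + Real.exp (-V (-r))) / 2 := by
  have h := convexOn_exp.2 (mem_univ (-V r)) (mem_univ (-V (-r)))
    (by norm_num : (0 : ℝ) ≤ 1 / 2) (by norm_num : (0 : ℝ) ≤ 1 / 2) (by norm_num)
  simp only [smul_eq_mul] at h
  rw [evenPart, show -((V r + V (-r)) / 2) = 1 / 2 * -V r + 1 / 2 * -V (-r) by ring]
  linarith

theorem integrable_exp_neg_evenPart {V : ℝ → ℝ} (hV : Continuous V)
    (hint : Integrable fun r => Real.exp (-V r)) :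
    Integrable fun r => Real.exp (-evenPart V r) := by
  refine ((hint.add hint.comp_neg).div_const 2).mono'
    (by have := continuous_evenPart hV; fun_prop) (.of_forall fun r => ?_)
  rw [Real.norm_of_nonneg (Real.exp_pos _).le]
  exact exp_neg_evenPart_le V r

variable {d N : ℕ}

theorem continuous_height (x : Fin d → ℤ) : Continuous fun φ : Interface d N => height φ x := by
  unfold height
  split_ifs <;> fun_prop

theorem continuous_hamiltonian {V : ℝ → ℝ} (hV : Continuous V) :
    Continuous (hamiltonian d N V) := by
  have := continuous_height (d := d) (N := N)
  unfold hamiltonian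
  fun_prop

theorem height_coe (φ : Interface d N) (x : ↥(box d N)) : height φ x = φ x := by
  simp [height]

theorem height_update_of_ne (φ : Interface d N) {y : ↥(box d N)} (t : ℝ≥0) {z : Fin d → ℤ}
    (hz : z ≠ y) : height (Function.update φ y t) z = height φ z := by
  unfold height
  split_ifs with h
  · rw [Function.update_of_ne fun hy => hz (congrArg Subtype.val hy)]
  · rfl

theorem nbr_comm {x y : Fin d → ℤ} : Nbr x y ↔ Nbr y x := by
  simp only [Nbr, sub_sq_comm]

theorem nbr_sub_single (x : Fin d → ℤ) (i : Fin d) : Nbr x (x - Pi.single i 1) := by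
  simp [Nbr, Pi.single_apply]

theorem sub_single_mem_closedBox {x : Fin d → ℤ} (hx : x ∈ box d N) (i : Fin d) :
    x - Pi.single i 1 ∈ closedBox d N := by
  by_cases h : x - Pi.single i 1 ∈ box d N
  · exact Finset.mem_union_left _ h
  · exact Finset.mem_union_right _
      ((mem_boundary _).2 ⟨h, x, hx, nbr_comm.1 (nbr_sub_single x i)⟩)

/-- The oriented nearest-neighbour bonds of the closed box. -/
def bonds (d N : ℕ) : Finset ((Fin d → ℤ) × (Fin d → ℤ)) :=
  (closedBox d N ×ˢ closedBox d N).filter fun p => Nbr p.1 p.2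

theorem hamiltonian_eq_sum_bonds (V : ℝ → ℝ) (φ : Interface d N) :
    hamiltonian d N V φ = 1 / 2 * ∑ p ∈ bonds d N, V (height φ p.1 - height φ p.2) := by
  simp only [hamiltonian, bonds, Finset.sum_filter, Finset.sum_product]

theorem swap_mem_bonds {p : (Fin d → ℤ) × (Fin d → ℤ)} (hp : p ∈ bonds d N) :
    p.swap ∈ bonds d N := by
  simp only [bonds, Finset.mem_filter, Finset.mem_product] at hp ⊢
  exact ⟨hp.1.symm, nbr_comm.1 hp.2⟩

theorem prodMk_sub_single_mem_bonds {x : Fin d → ℤ} (hx : x ∈ box d N) (i : Fin d) :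
    (x, x - Pi.single i 1) ∈ bonds d N :=
  Finset.mem_filter.2 ⟨Finset.mem_product.2
    ⟨Finset.mem_union_left _ hx, sub_single_mem_closedBox hx i⟩, nbr_sub_single x i⟩

theorem sum_box_le_sum_bonds {W : (Fin d → ℤ) × (Fin d → ℤ) → ℝ} (hW : ∀ p, 0 ≤ W p)
    (i : Fin d) :
    ∑ x ∈ box d N, (W (x, x - Pi.single i 1) + W (x - Pi.single i 1, x)) ≤
      ∑ p ∈ bonds d N, W p := by
  let down (x : Fin d → ℤ) : (Fin d → ℤ) × (Fin d → ℤ) := (x, x - Pi.single i 1)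
  have hdown : Function.Injective down := fun x y h => congrArg Prod.fst h
  have hdisj : Disjoint ((box d N).image down) ((box d N).image (Prod.swap ∘ down)) := by
    simp only [Finset.disjoint_left, Finset.mem_image, not_exists, not_and]
    rintro _ ⟨x, -, rfl⟩ y - hy
    have h₁ := congrFun (congrArg Prod.fst hy) i
    have h₂ := congrFun (congrArg Prod.snd hy) i
    simp [down] at h₁ h₂
    omega
  have hsub : (box d N).image down ∪ (box d N).image (Prod.swap ∘ down) ⊆ bonds d N := by
    refine Finset.union_subset ?_ ?_ <;> refine Finset.image_subset_iff.2 fun x hx => ?_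
    · exact prodMk_sub_single_mem_bonds hx i
    · exact swap_mem_bonds (prodMk_sub_single_mem_bonds hx i)
  have hle := Finset.sum_le_sum_of_subset_of_nonneg hsub fun p _ _ => hW p
  rwa [Finset.sum_union hdisj, Finset.sum_image hdown.injOn,
    Finset.sum_image (Prod.swap_injective.comp hdown).injOn, ← Finset.sum_add_distrib] at hle

theorem sum_evenPart_sub_le_hamiltonian {V : ℝ → ℝ} {m : ℝ} (hm : ∀ r, m ≤ V r) (i : Fin d)
    (φ : Interface d N) :
    ∑ x ∈ box d N, (evenPart V (height φ x - height φ (x - Pi.single i 1)) - m) +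
      (bonds d N).card * m / 2 ≤ hamiltonian d N V φ := by
  have hle := sum_box_le_sum_bonds (d := d) (N := N)
    (W := fun p => V (height φ p.1 - height φ p.2) - m) (fun p => sub_nonneg.2 (hm _)) i
  have hpair (x : Fin d → ℤ) : V (height φ x - height φ (x - Pi.single i 1)) - m +
      (V (height φ (x - Pi.single i 1) - height φ x) - m) =
      2 * (evenPart V (height φ x - height φ (x - Pi.single i 1)) - m) := by
    rw [evenPart, neg_sub]
    ring
  simp only [hpair] at hle
  rw [← Finset.mul_sum, Finset.sum_sub_distrib (s := bonds d N), Finset.sum_const,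
    nsmul_eq_mul] at hle
  rw [hamiltonian_eq_sum_bonds]
  linarith

theorem ofReal_exp_neg_hamiltonian_le {V : ℝ → ℝ} {m : ℝ} (hm : ∀ r, m ≤ V r) (i : Fin d)
    (φ : Interface d N) :
    ENNReal.ofReal (Real.exp (-hamiltonian d N V φ)) ≤
      ENNReal.ofReal (Real.exp (-((bonds d N).card * m / 2))) *
        ∏ x : ↥(box d N), ENNReal.ofReal
          (Real.exp (m - evenPart V (height φ x - height φ (x.1 - Pi.single i 1)))) := by
  rw [← ENNReal.ofReal_prod_of_nonneg fun _ _ => (Real.exp_pos _).le, ← Real.exp_sum,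
    ← ENNReal.ofReal_mul (Real.exp_pos _).le, ← Real.exp_add]
  refine ENNReal.ofReal_le_ofReal (Real.exp_le_exp.2 ?_)
  have hle := sum_evenPart_sub_le_hamiltonian hm i φ
  rw [← Finset.sum_coe_sort, Finset.sum_sub_distrib] at hle
  rw [Finset.sum_sub_distrib]
  linarith

theorem lintegral_prod_height_sub_le (s : ℝ) {g : ℝ → ℝ≥0∞} (hgm : Measurable g)
    (hg : ∀ r, g r ≤ 1) (i : Fin d) :
    ∫⁻ φ, ∏ x : ↥(box d N), g (height φ x - height φ (x.1 - Pi.single i 1)) ∂(refMeasure d N s) ≤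
      (ENNReal.ofReal s + ∫⁻ r, g r) ^ (box d N).card := by
  have hmeas (x : ↥(box d N)) : Measurable fun φ : Interface d N =>
      g (height φ x - height φ (x.1 - Pi.single i 1)) :=
    hgm.comp ((continuous_height _).sub (continuous_height _)).measurable
  have hne (x : Fin d → ℤ) : x - Pi.single i 1 ≠ x := by simp
  have hbound := lmarginal_prod_le_prod (ν := fun _ => siteMeasure s) hmeas (fun x => x.1 i)
    (fun x y hxy hle φ t => by
      have hy : x.1 - Pi.single i 1 ≠ y.1 := fun h => by
        have := congrFun h i
        simp at this
        omega
      rw [height_update_of_ne φ t (Subtype.coe_injective.ne hxy), height_update_of_ne φ t hy])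
    (K := fun _ => ENNReal.ofReal s + ∫⁻ r, g r)
    (fun x φ => by
      simp only [height_coe, Function.update_self, height_update_of_ne φ _ (hne x)]
      exact lintegral_siteMeasure_sub_le s hg _) Finset.univ 0
  rwa [← lintegral_eq_lmarginal_univ, Finset.prod_const, Finset.card_univ,
    Fintype.card_coe] at hbound

theorem partitionFunction_ne_top (hd : 1 ≤ d) (s : ℝ) {V : ℝ → ℝ} (hV : Continuous V)
    (hb : BddBelow (range V)) (hint : Integrable fun r => Real.exp (-V r)) :
    partitionFunction d N s V ≠ ∞ := by
  obtain ⟨m, hm⟩ := hb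
  have hm (r : ℝ) : m ≤ V r := hm (mem_range_self r)
  let i : Fin d := ⟨0, hd⟩
  let g (r : ℝ) : ℝ≥0∞ := ENNReal.ofReal (Real.exp (m - evenPart V r))
  have hgm : Measurable g := by
    have := continuous_evenPart hV
    fun_prop
  have hg1 (r : ℝ) : g r ≤ 1 := by
    rw [ENNReal.ofReal_le_one, Real.exp_le_one_iff, sub_nonpos]
    exact le_evenPart hm r
  have hgint : ∫⁻ r, g r ≠ ∞ := by
    have := (integrable_exp_neg_evenPart hV hint).const_mul (Real.exp m)
    simp only [← Real.exp_add, ← sub_eq_add_neg] at this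
    exact this.lintegral_lt_top.ne
  refine ne_top_of_le_ne_top ?_ (lintegral_mono (ofReal_exp_neg_hamiltonian_le hm i))
  rw [lintegral_const_mul' _ _ ENNReal.ofReal_ne_top]
  exact ENNReal.mul_ne_top ENNReal.ofReal_ne_top (ne_top_of_le_ne_top
    (ENNReal.pow_ne_top (ENNReal.add_ne_top.2 ⟨ENNReal.ofReal_ne_top, hgint⟩))
    (lintegral_prod_height_sub_le s hgm hg1 i))

theorem measurable_ofReal_exp_neg_hamiltonian {V : ℝ → ℝ} (hV : Continuous V) :
    Measurable fun φ : Interface d N => ENNReal.ofReal (Real.exp (-hamiltonian d N V φ)) := by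
  have := continuous_hamiltonian (d := d) (N := N) hV
  fun_prop

theorem partitionFunction_ne_zero (s : ℝ) {V : ℝ → ℝ} (hV : Continuous V) :
    partitionFunction d N s V ≠ 0 := by
  refine ((lintegral_pos_iff_support (measurable_ofReal_exp_neg_hamiltonian hV)).2 ?_).ne'
  have hsupp : Function.support (fun φ : Interface d N =>
      ENNReal.ofReal (Real.exp (-hamiltonian d N V φ))) = univ :=
    eq_univ_of_forall fun φ => (ENNReal.ofReal_pos.2 (Real.exp_pos _)).ne'
  rw [hsupp]
  exact isOpen_univ.measure_pos (piRef ↥(box d N) s) univ_nonempty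

end PartitionFunction

/-! ### The Gibbs measure and the wetting form -/

section Gibbs

variable {d N : ℕ}

/-- The density of the Gibbs measure with respect to the reference measure. -/
def gibbsDensity (d N : ℕ) (s : ℝ) (V : ℝ → ℝ) (φ : Interface d N) : ℝ :=
  Real.exp (-hamiltonian d N V φ) / (partitionFunction d N s V).toReal

theorem hasPosDensity_gibbs (hd : 1 ≤ d) (s : ℝ) {V : ℝ → ℝ} (hV : Continuous V)
    (hb : BddBelow (range V)) (hint : Integrable fun r => Real.exp (-V r)) :
    HasPosDensity s (gibbsDensity d N s V) (gibbs d N s V) := by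
  have htop : partitionFunction d N s V ≠ ∞ := partitionFunction_ne_top hd s hV hb hint
  have hZ : 0 < (partitionFunction d N s V).toReal :=
    ENNReal.toReal_pos (partitionFunction_ne_zero s hV) htop
  refine ⟨?_, fun φ => div_pos (Real.exp_pos _) hZ, ?_⟩
  · have := continuous_hamiltonian (d := d) (N := N) hV
    unfold gibbsDensity
    fun_prop
  · simp only [gibbsDensity, ENNReal.ofReal_div_of_pos hZ, ENNReal.ofReal_toReal htop]
    rfl

theorem isProbabilityMeasure_gibbs (hd : 1 ≤ d) (s : ℝ) {V : ℝ → ℝ} (hV : Continuous V)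
    (hb : BddBelow (range V)) (hint : Integrable fun r => Real.exp (-V r)) :
    IsProbabilityMeasure (gibbs d N s V) where
  measure_univ := by
    rw [gibbs, withDensity_apply _ MeasurableSet.univ, Measure.restrict_univ]
    simp only [div_eq_mul_inv]
    rw [lintegral_mul_const _ (measurable_ofReal_exp_neg_hamiltonian hV)]
    exact ENNReal.mul_inv_cancel (partitionFunction_ne_zero s hV)
      (partitionFunction_ne_top hd s hV hb hint)

theorem measurableSet_wet (B : Finset ↥(box d N)) : MeasurableSet (wet B) :=
  measurableSet_setOfPred.2 (.forall fun x =>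
    (measurableSet_setOfPred.1 (measurableSet_posSet x)).iff measurable_const)

theorem pairwise_disjoint_wet : Pairwise (Function.onFun Disjoint (wet (d := d) (N := N))) :=
  fun _ _ hne => Set.disjoint_left.2 fun _ hB hC =>
    hne (Finset.ext fun x => (hB x).symm.trans (hC x))

theorem biUnion_wet (x : ↥(box d N)) :
    ⋃ B ∈ Finset.univ.filter (fun B : Finset ↥(box d N) => x ∈ B), wet B = posSet x := by
  ext φ
  simp only [Finset.mem_filter, Finset.mem_univ, true_and, mem_iUnion, exists_prop]
  constructor
  · rintro ⟨B, hx, hφ⟩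
    exact (hφ x).2 hx
  · intro hφ
    exact ⟨Finset.univ.filter fun y => 0 < φ y, by simpa [posSet] using hφ, fun y => by simp⟩

theorem wettingEnergy_eq_sum_setIntegral_posSet {s : ℝ} {V : ℝ → ℝ} {F G : Interface d N → ℝ}
    (hi : ∀ x, IntegrableOn (fun φ => pderiv x F φ * pderiv x G φ) (posSet x) (gibbs d N s V)) :
    wettingEnergy d N s V F G =
      ∑ x, ∫ φ in posSet x, pderiv x F φ * pderiv x G φ ∂(gibbs d N s V) := by
  have hempty : wettingEnergy d N s V F G = ∑ B : Finset ↥(box d N),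
      ∑ x ∈ B, ∫ φ in wet B, pderiv x F φ * pderiv x G φ ∂(gibbs d N s V) := by
    refine Finset.sum_subset (Finset.filter_subset _ _) fun B _ hB => ?_
    rw [show B = ∅ by simpa using hB, Finset.sum_empty]
  rw [hempty, Finset.sum_comm' (t' := Finset.univ)
    (s' := fun x => Finset.univ.filter fun B : Finset ↥(box d N) => x ∈ B) (by simp)]
  refine Finset.sum_congr rfl fun x _ => ?_
  have hix := hi x
  rw [← biUnion_wet x] at hix ⊢
  exact (integral_biUnion_finset _ (fun B _ => measurableSet_wet B)
    (pairwise_disjoint_wet.set_pairwise _) (integrableOn_finset_iUnion.1 hix)).symm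

theorem isWettingForm_ofOperator_gradOp {s : ℝ} {V : ℝ → ℝ} {ρ : Interface d N → ℝ}
    [IsFiniteMeasure (gibbs d N s V)] (h : HasPosDensity s ρ (gibbs d N s V)) :
    IsWettingForm d N s V (L2Form.ofOperator (gradOp (gibbs d N s V))) := by
  have hi {F G : Interface d N → ℝ} (hF : IsCc 2 F) (hG : IsCc 2 G) (x : ↥(box d N)) :
      Integrable (fun φ => pderiv x F φ * pderiv x G φ) (gibbs d N s V) :=
    (hF.memLp_pderiv two_ne_zero x _).integrable_mul (hG.memLp_pderiv two_ne_zero x _)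
  exact
    { memLp F hF := hF.memLp _
      mem_domain _ := mem_domain_gradOp
      integrable F G hF hG B x _ := (hi hF hG x).integrableOn
      form_eq F G hF hG u v hu hv := by
        rw [wettingEnergy_eq_sum_setIntegral_posSet fun x => (hi hF hG x).integrableOn]
        exact h.ofOperator_gradOp_form hF hG hu hv }

end Gibbs

end Wetting

end

theorem mainTheorem10_general (d N : ℕ) (hd : 1 ≤ d) (s : ℝ≥0) (V : ℝ → ℝ) (hV : Continuous V)
    (hb : BddBelow (range V)) (hint : Integrable fun r => Real.exp (-V r)) :
    IsProbabilityMeasure (Wetting.gibbs d N s V) ∧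
    ∃ 𝓔 : Wetting.L2Form (Wetting.gibbs d N s V), Wetting.IsWettingForm d N s V 𝓔 ∧
      𝓔.IsDenselyDefined ∧ 𝓔.IsPositive ∧ 𝓔.IsSymm ∧ 𝓔.IsClosable ∧
      ∃ 𝓕 : Wetting.L2Form (Wetting.gibbs d N s V), 𝓕.IsClosureOf 𝓔 ∧
        𝓕.IsSymmDirichletForm ∧ 𝓕.IsRegular ∧ 𝓕.IsStronglyLocal ∧ 𝓕.IsConservative := by
  have hprob := Wetting.isProbabilityMeasure_gibbs (N := N) hd s hV hb hint
  have h := Wetting.hasPosDensity_gibbs (N := N) hd s hV hb hint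
  let A := Wetting.gradOp (Wetting.gibbs d N s V)
  exact ⟨hprob, .ofOperator A, Wetting.isWettingForm_ofOperator_gradOp h,
    Wetting.ofOperator_gradOp_isDenselyDefined _, Wetting.L2Form.ofOperator_isPositive,
    Wetting.L2Form.ofOperator_isSymm, Wetting.L2Form.ofOperator_isClosable h.isClosable_gradOp,
    .ofOperator A.closure, h.isClosureOf, h.isSymmDirichletForm, h.isRegular, h.isStronglyLocal,
    h.isConservative⟩

theorem mainTheorem10 (d N : ℕ) (hd : 1 ≤ d) (hN : 1 ≤ N) (s : ℝ) (hs : 0 < s)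
    (V : ℝ → ℝ) (hV : Wetting.IsPairPotential d N s V) :
    IsProbabilityMeasure (Wetting.gibbs d N s V) ∧
    ∃ 𝓔 : Wetting.L2Form (Wetting.gibbs d N s V), Wetting.IsWettingForm d N s V 𝓔 ∧
      𝓔.IsDenselyDefined ∧ 𝓔.IsPositive ∧ 𝓔.IsSymm ∧ 𝓔.IsClosable ∧
      ∃ 𝓕 : Wetting.L2Form (Wetting.gibbs d N s V), 𝓕.IsClosureOf 𝓔 ∧
        𝓕.IsSymmDirichletForm ∧ 𝓕.IsRegular ∧ 𝓕.IsStronglyLocal ∧ 𝓕.IsConservative :=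
  have ⟨b, _, hb⟩ := hV.bounded_below
  mainTheorem10_general d N hd ⟨s, hs.le⟩ V hV.contDiff.continuous
    ⟨-b, forall_mem_range.2 hb⟩ hV.integrable
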